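/- Let $\alpha\ge 1$. For each $n$, let the distances $L_{ij}=L_{ji}$, $1\le i<j\le n$, between $n$ cities $1,\dots,n$ be i.i.d. random variables with the Weibull distribution with shape parameter $1+\alpha$ and scale parameter $1$, i.e. with density $f(t)=(1+\alpha)t^{\alpha}e^{-t^{1+\alpha}}\mathbf 1(t>0)$. Let $v_1,\dots,v_n$ be the nearest neighbour tour started at city $1$: $v_1=1$ and, for $1\le i<n$, $v_{i+1}$ is a city $u\notin\{v_1,\dots,v_i\}$ that minimizes $L_{v_i u}$ (ties being broken arbitrarily). Put $v_{n+1}=1$, let $T_n=\sum_{i=1}^{n}L_{v_iv_{i+1}}$ be the length of the closed tour (with $L_{11}=0$ when $n=1$), and let $\sigma^2(\alpha)=\Gamma\left(\frac{2}{1+\alpha}+1\right)-\Gamma^2\left(1+\frac{1}{1+\alpha}\right)$. Then $T_n$ is integrable for every $n$ and, as $n\to\infty$, the following hold, where $\xrightarrow{d}$ denotes convergence in distribution. If $\alpha>1$, then $$\frac{T_n-\mathbb E[T_n]}{n^{\frac12-\frac1{1+\alpha}}}\xrightarrow{d}N\left(0,\frac{\alpha+1}{\alpha-1}\,\sigma^2(\alpha)\right).$$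 If $\alpha=1$, then $$\frac{T_n-\mathbb E[T_n]}{\sqrt{\log n}}\xrightarrow{d}N\left(0,\sigma^2(1)\right).$$ -/

import Mathlib

open MeasureTheory ProbabilityTheory Filter

noncomputable section

namespace NNTour

/-- Density of the Weibull distribution with shape `k` and scale `lam` (both positive). -/
def weibullPDFReal (k lam x : ℝ) : ℝ :=
  if 0 < x then k / lam * (x / lam) ^ (k - 1) * Real.exp (-(x / lam) ^ k) else 0

/-- The Weibull distribution with shape `k` and scale `lam`, as a measure on `ℝ`. -/
def weibullMeasure (k lam : ℝ) : Measure ℝ :=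
  volume.withDensity fun x => ENNReal.ofReal (weibullPDFReal k lam x)

/-- The pairs `i < j` of cities, where the `n` cities are the elements of `Fin n`
(the first city being `0`). -/
abbrev Edge (n : ℕ) : Type := {p : Fin n × Fin n // p.1 < p.2}

/-- The symmetric distance function with prescribed distance `L (i, j)` for `i < j`
(and `0` on the diagonal). -/
def cityDist {n : ℕ} (L : Edge n → ℝ) (i j : Fin n) : ℝ :=
  if h : i < j then L ⟨(i, j), h⟩ else if h : j < i then L ⟨(j, i), h⟩ else 0

/-- `v` is a tour that the nearest neighbour algorithm can output for the distances `d`, when ties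
are broken arbitrarily: it starts at the first city, and after the cities `v 0, …, v i` have been
visited the next city `v (i + 1)` is one that minimises the distance from `v i` among the
cities not visited so far. -/
structure IsNNTour {n : ℕ} (d : Fin n → Fin n → ℝ) (v : Equiv.Perm (Fin n)) : Prop where
  start : ∀ i : Fin n, i.val = 0 → v i = i
  nearest : ∀ i j : Fin n, j.val = i.val + 1 →
    ∀ u : Fin n, (∀ k : Fin n, k ≤ i → u ≠ v k) → d (v i) (v j) ≤ d (v i) u

/-- Length of the closed tour `v 0, v 1, …, v (n - 1), v 0`
(`finRotate n` is the cyclic successor on `Fin n`). -/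
def tourLength {n : ℕ} (d : Fin n → Fin n → ℝ) (v : Equiv.Perm (Fin n)) : ℝ :=
  ∑ i : Fin n, d (v i) (v (finRotate n i))

/-- `σ²(α) = Γ(2/(1+α) + 1) - Γ(1 + 1/(1+α))²`. -/
def sigmaSq (α : ℝ) : ℝ :=
  Real.Gamma (2 / (1 + α) + 1) - Real.Gamma (1 + 1 / (1 + α)) ^ 2

end NNTour

end

noncomputable section

namespace NNTour

open Set
open scoped Topology

/-! ### The Weibull distribution with scale `1` -/

/-! Put `k = 1 + α` and take `N + 1` cities. Fix a permutation `σ` with `σ 0 = 0` and arrange the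
edges in rows, row `i` holding the `N - i` edges from `σ i` to the later cities. The rows are
disjoint, hence independent, and `σ` is a nearest neighbour tour exactly when in every row the edge
to the next city is the least (`mem_tourSet_iff`). Both this event and the exponential of the path
length therefore factor over the rows.

In a row of `m` edges a prescribed edge is the least with probability `1 / m`, and on that event its
length is distributed as `m ^ (-1 / k)` times a Weibull variable
(`integral_indicator_isLeastAt_weibullMeasure`). So `σ` is a nearest neighbour tour with probability
`1 / N!`, and the conditional law of its open path length does not depend on `σ`. Summing over the
`N!` permutations, the open path has the law of `∑ m ^ (-1 / k) W_m`, `1 ≤ m ≤ N`, with independent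
Weibull `W_m` (`charFun_map_tourSum_pathLength`). The same count gives uniqueness: the events have
total probability `1`, and some tour always exists, so almost surely there is exactly one and
tie-breaking is irrelevant.

The closing edge is nonnegative with bounded mean (`integral_tourSum_cityDist_le`), so division by a
normalising constant tending to infinity removes it in `L¹`. What remains is a weighted sum of
independent copies of one variable, with uniformly small weights, and Lindeberg's theorem applies
(`tendsto_prod_charFun_mul`). The limiting variance comes from `∑ m ^ (-2 / k)`, which grows like a
power of `N` for `α > 1` and like `log N` for `α = 1`. -/

lemma weibullPDFReal_one_of_pos (k : ℝ) {x : ℝ} (hx : 0 < x) :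
    weibullPDFReal k 1 x = k * x ^ (k - 1) * Real.exp (-x ^ k) := by
  simp [weibullPDFReal, hx]

lemma weibullPDFReal_nonneg {k : ℝ} (hk : 0 < k) (x : ℝ) : 0 ≤ weibullPDFReal k 1 x := by
  unfold weibullPDFReal
  split_ifs with h
  · have : 0 ≤ x := h.le
    positivity
  · exact le_rfl

lemma measurable_weibullPDFReal (k : ℝ) : Measurable (weibullPDFReal k 1) := by
  unfold weibullPDFReal
  refine Measurable.ite measurableSet_Ioi ?_ measurable_const
  fun_prop

lemma weibullPDFReal_eq_indicator (k : ℝ) :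
    weibullPDFReal k 1 = (Ioi (0 : ℝ)).indicator fun x => k * x ^ (k - 1) * Real.exp (-x ^ k) := by
  ext x
  by_cases hx : 0 < x
  · simp [weibullPDFReal, hx]
  · simp [weibullPDFReal, hx]

lemma integral_weibullMeasure {E : Type*} [NormedAddCommGroup E] [NormedSpace ℝ E]
    {k : ℝ} (hk : 0 < k) (g : ℝ → E) :
    ∫ x, g x ∂(weibullMeasure k 1) =
      ∫ x in Ioi (0 : ℝ), (k * x ^ (k - 1) * Real.exp (-x ^ k)) • g x := by
  rw [weibullMeasure, integral_withDensity_eq_integral_toReal_smul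
    (measurable_weibullPDFReal k).ennreal_ofReal (by simp), ← integral_indicator measurableSet_Ioi]
  congr 1 with x
  rw [ENNReal.toReal_ofReal (weibullPDFReal_nonneg hk x), weibullPDFReal_eq_indicator]
  by_cases hx : x ∈ Ioi (0 : ℝ) <;> simp [hx]

lemma integrable_weibullMeasure_iff {E : Type*} [NormedAddCommGroup E] [NormedSpace ℝ E]
    {k : ℝ} (hk : 0 < k) (g : ℝ → E) :
    Integrable g (weibullMeasure k 1) ↔
      IntegrableOn (fun x => (k * x ^ (k - 1) * Real.exp (-x ^ k)) • g x) (Ioi 0) := by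
  rw [weibullMeasure, integrable_withDensity_iff_integrable_smul'
    (measurable_weibullPDFReal k).ennreal_ofReal (by simp), ← integrable_indicator_iff
    measurableSet_Ioi]
  refine integrable_congr (ae_of_all _ fun x => ?_)
  dsimp only
  rw [ENNReal.toReal_ofReal (weibullPDFReal_nonneg hk x), weibullPDFReal_eq_indicator]
  by_cases hx : x ∈ Ioi (0 : ℝ) <;> simp [hx]

lemma hasDerivAt_neg_exp_neg_rpow (k : ℝ) {x : ℝ} (hx : 0 < x) :
    HasDerivAt (fun x : ℝ => -Real.exp (-x ^ k)) (k * x ^ (k - 1) * Real.exp (-x ^ k)) x := by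
  have h := ((Real.hasDerivAt_rpow_const (x := x) (p := k) (Or.inl hx.ne')).neg.exp).neg
  convert! h using 1
  simp only [Pi.neg_apply]
  ring

lemma tendsto_neg_exp_neg_rpow {k : ℝ} (hk : 0 < k) :
    Tendsto (fun x : ℝ => -Real.exp (-x ^ k)) atTop (nhds 0) := by
  have := (Real.tendsto_exp_neg_atTop_nhds_zero.comp (tendsto_rpow_atTop hk)).neg
  simpa using this

lemma continuous_neg_exp_neg_rpow {k : ℝ} (hk : 0 < k) :
    Continuous (fun x : ℝ => -Real.exp (-x ^ k)) :=
  ((Real.continuous_rpow_const hk.le).neg.rexp).neg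

lemma weibullMeasure_Ioi {k : ℝ} (hk : 0 < k) {x : ℝ} (hx : 0 ≤ x) :
    weibullMeasure k 1 (Ioi x) = ENNReal.ofReal (Real.exp (-x ^ k)) := by
  have hnn : ∀ y ∈ Ioi x, 0 ≤ k * y ^ (k - 1) * Real.exp (-y ^ k) := fun y hy => by
    have : 0 ≤ y := hx.trans (le_of_lt hy)
    positivity
  have hint := integrableOn_Ioi_deriv_of_nonneg (a := x)
    (continuous_neg_exp_neg_rpow hk).continuousWithinAt
    (fun y hy => hasDerivAt_neg_exp_neg_rpow k (hx.trans_lt hy)) hnn (tendsto_neg_exp_neg_rpow hk)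
  have hval := integral_Ioi_of_hasDerivAt_of_nonneg (a := x)
    (continuous_neg_exp_neg_rpow hk).continuousWithinAt
    (fun y hy => hasDerivAt_neg_exp_neg_rpow k (hx.trans_lt hy)) hnn (tendsto_neg_exp_neg_rpow hk)
  rw [weibullMeasure, withDensity_apply _ measurableSet_Ioi,
    setLIntegral_congr_fun (g := fun y => ENNReal.ofReal (k * y ^ (k - 1) * Real.exp (-y ^ k)))
      measurableSet_Ioi
      (fun y hy => by simp only [weibullPDFReal_one_of_pos k (hx.trans_lt hy)]),
    ← ofReal_integral_eq_lintegral_ofReal hint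
      ((ae_restrict_iff' measurableSet_Ioi).2 (ae_of_all _ hnn)), hval]
  simp

lemma weibullMeasure_Iic_zero (k : ℝ) : weibullMeasure k 1 (Iic 0) = 0 := by
  rw [weibullMeasure, withDensity_apply _ measurableSet_Iic, setLIntegral_eq_zero_iff
    measurableSet_Iic (measurable_weibullPDFReal k).ennreal_ofReal]
  refine ae_of_all _ fun x hx => ?_
  simp [weibullPDFReal, not_lt.2 (mem_Iic.1 hx)]

lemma isProbabilityMeasure_weibullMeasure {k : ℝ} (hk : 0 < k) :
    IsProbabilityMeasure (weibullMeasure k 1) := by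
  refine ⟨?_⟩
  rw [← Iic_union_Ioi (a := (0 : ℝ)), measure_union (Iic_disjoint_Ioi le_rfl) measurableSet_Ioi,
    weibullMeasure_Iic_zero, weibullMeasure_Ioi hk le_rfl]
  simp [Real.zero_rpow hk.ne']

lemma ae_pos_weibullMeasure (k : ℝ) : ∀ᵐ x ∂(weibullMeasure k 1), 0 < x := by
  rw [ae_iff]
  have : {a : ℝ | ¬ 0 < a} = Iic 0 := by ext; simp
  rw [this, weibullMeasure_Iic_zero]

lemma weibullMeasure_real_Ici {k : ℝ} (hk : 0 < k) {x : ℝ} (hx : 0 ≤ x) :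
    (weibullMeasure k 1).real (Ici x) = Real.exp (-x ^ k) := by
  have : weibullMeasure k 1 (Ici x) = weibullMeasure k 1 (Ioi x) := by
    refine measure_congr ?_
    have hac : weibullMeasure k 1 ≪ volume := withDensity_absolutelyContinuous _ _
    exact hac.ae_eq Ioi_ae_eq_Ici.symm
  rw [measureReal_def, this, weibullMeasure_Ioi hk hx, ENNReal.toReal_ofReal (Real.exp_pos _).le]

lemma integrable_pow_weibullMeasure {k : ℝ} (hk : 0 < k) (n : ℕ) :
    Integrable (fun x => x ^ n) (weibullMeasure k 1) := by
  rw [integrable_weibullMeasure_iff hk]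
  have h := (integrableOn_rpow_mul_exp_neg_rpow (p := k) (s := k - 1 + n)
    (by have : (0 : ℝ) ≤ n := n.cast_nonneg
        linarith) hk).const_mul k
  refine IntegrableOn.congr_fun h (fun x hx => ?_) measurableSet_Ioi
  simp only [smul_eq_mul]
  rw [Real.rpow_add hx, Real.rpow_natCast]
  ring

lemma integral_pow_weibullMeasure {k : ℝ} (hk : 0 < k) (n : ℕ) :
    ∫ x, x ^ n ∂(weibullMeasure k 1) = Real.Gamma (n / k + 1) := by
  rw [integral_weibullMeasure hk]
  have hn : (0 : ℝ) ≤ n := n.cast_nonneg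
  have h := integral_rpow_mul_exp_neg_rpow (p := k) (q := k - 1 + n) hk (by linarith)
  have h2 : ∫ x in Ioi (0 : ℝ), (k * x ^ (k - 1) * Real.exp (-x ^ k)) • x ^ n =
      ∫ x in Ioi (0 : ℝ), k * (x ^ (k - 1 + n) * Real.exp (-x ^ k)) := by
    refine setIntegral_congr_fun measurableSet_Ioi fun x hx => ?_
    simp only [smul_eq_mul]
    rw [Real.rpow_add hx, Real.rpow_natCast]
    ring
  rw [h2, integral_const_mul, h, show (k - 1 + n + 1) / k = n / k + 1 by field_simp; ring]
  field_simp

/-- The law of a Weibull variable on the event that it is the least of `m + 1` independent copies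
is `1 / (m + 1)` times the law of the variable scaled by `(m + 1) ^ (-1 / k)`. -/
lemma integral_weibullMeasure_Ici_pow_smul {E : Type*} [NormedAddCommGroup E] [NormedSpace ℝ E]
    {k : ℝ} (hk : 0 < k) (m : ℕ) (g : ℝ → E) :
    ∫ x, (weibullMeasure k 1).real (Ici x) ^ m • g x ∂(weibullMeasure k 1) =
      (1 / (m + 1 : ℝ)) • ∫ x, g ((m + 1 : ℝ) ^ (-(1 / k)) * x) ∂(weibullMeasure k 1) := by
  have hm : (0 : ℝ) < m + 1 := by positivity
  set b : ℝ := (m + 1 : ℝ) ^ (1 / k) with hb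
  have hbpos : 0 < b := by positivity
  have hbk : b ^ k = m + 1 := by
    rw [hb, ← Real.rpow_mul hm.le]
    simp [hk.ne']
  have hbinv : (m + 1 : ℝ) ^ (-(1 / k)) = b⁻¹ := by rw [Real.rpow_neg hm.le]
  rw [integral_weibullMeasure hk, integral_weibullMeasure hk, hbinv]
  -- The `m`-th power of the tail times the density has exponential factor `exp (-(m + 1) x ^ k) =
  -- exp (-(b x) ^ k)`, so the substitution `x ↦ b x` restores the Weibull density.
  have hsub := integral_comp_mul_left_Ioi'
    (fun x : ℝ => (k * x ^ (k - 1) * Real.exp (-x ^ k)) • g (b⁻¹ * x)) 0 hbpos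
  rw [mul_zero] at hsub
  rw [← hsub, smul_smul, ← integral_smul]
  refine setIntegral_congr_fun measurableSet_Ioi fun x hx => ?_
  have hx0 : 0 < x := hx
  simp only [weibullMeasure_real_Ici hk hx0.le, smul_smul]
  rw [inv_mul_cancel_left₀ hbpos.ne', Real.mul_rpow hbpos.le hx0.le, Real.mul_rpow hbpos.le hx0.le,
    hbk, Real.rpow_sub_one hbpos.ne', hbk]
  congr 1
  rw [show -((m + 1 : ℝ) * x ^ k) = m * (-x ^ k) + -x ^ k by ring, Real.exp_add, Real.exp_nat_mul]
  field_simp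

/-! ### Minima of independent variables -/

section Rows

variable {κ : Type*} [Fintype κ]

/-- `y a` is a least value of `y`. -/
def IsLeastAt (a : κ) (y : κ → ℝ) : Prop := ∀ j, y a ≤ y j

lemma measurableSet_isLeastAt (a : κ) : MeasurableSet {y : κ → ℝ | IsLeastAt a y} := by
  simp only [IsLeastAt, ofPred_forall]
  exact MeasurableSet.iInter fun j =>
    measurableSet_le (measurable_pi_apply a) (measurable_pi_apply j)

lemma measurePreserving_eval_prod_compl [DecidableEq κ] (ν : Measure ℝ) [IsProbabilityMeasure ν]
    (a : κ) :
    MeasurePreserving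
      (fun y : κ → ℝ => (y a, fun j : {j // ¬ j = a} => y j)) (Measure.pi fun _ => ν)
      (ν.prod (Measure.pi fun _ : {j // ¬ j = a} => ν)) := by
  have he := measurePreserving_piEquivPiSubtypeProd (fun _ : κ => ν) (fun j => j = a)
  have hu : MeasurePreserving (MeasurableEquiv.piUnique fun _ : {j // j = a} => ℝ)
    (@Measure.pi {j // j = a} _ (Subtype.fintype _) _ fun _ => ν) ν := by
    convert measurePreserving_piUnique (fun _ : {j // j = a} => ν)
  exact (hu.prod (MeasurePreserving.id (Measure.pi fun _ : {j // ¬ j = a} => ν))).comp he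

/-- Given `y a = x`, each of the other `card κ - 1` coordinates lies in `Ici x` independently;
Fubini gives the power. -/
lemma integral_indicator_isLeastAt {E : Type*} [NormedAddCommGroup E] [NormedSpace ℝ E]
    [CompleteSpace E] (ν : Measure ℝ) [IsProbabilityMeasure ν] (a : κ) {g : ℝ → E}
    (hg : Integrable g ν) :
    ∫ y, {y : κ → ℝ | IsLeastAt a y}.indicator (fun y => g (y a)) y ∂(Measure.pi fun _ => ν) =
      ∫ x, ν.real (Ici x) ^ (Fintype.card κ - 1) • g x ∂ν := by
  classical
  have hpair := measurePreserving_eval_prod_compl ν a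
  set F : ℝ × ({j // ¬ j = a} → ℝ) → E :=
    {q : ℝ × ({j // ¬ j = a} → ℝ) | ∀ j, q.1 ≤ q.2 j}.indicator (fun q => g q.1) with hF
  have hms : MeasurableSet {q : ℝ × ({j // ¬ j = a} → ℝ) | ∀ j, q.1 ≤ q.2 j} := by
    simp only [ofPred_forall]
    exact MeasurableSet.iInter fun j => measurableSet_le measurable_fst
      ((measurable_pi_apply j).comp measurable_snd)
  have hFint : Integrable F (ν.prod (Measure.pi fun _ : {j // ¬ j = a} => ν)) :=
    (hg.comp_fst _).indicator hms
  have h1 : ∀ y : κ → ℝ, {y : κ → ℝ | IsLeastAt a y}.indicator (fun y => g (y a)) y =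
      F (y a, fun j : {j // ¬ j = a} => y j) := by
    intro y
    have : IsLeastAt a y ↔ ∀ j : {j // ¬ j = a}, y a ≤ y j := by
      refine ⟨fun h j => h j, fun h j => ?_⟩
      by_cases hj : j = a
      · rw [hj]
      · exact h ⟨j, hj⟩
    simp only [hF, indicator_apply, mem_ofPred_eq, this]
  simp_rw [h1]
  rw [← integral_map (f := F) hpair.measurable.aemeasurable
    (by rw [hpair.map_eq]; exact hFint.aestronglyMeasurable), hpair.map_eq, integral_prod _ hFint]
  refine integral_congr_ae (ae_of_all _ fun x => ?_)
  have h2 : ∀ z : {j // ¬ j = a} → ℝ, F (x, z) =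
      (Set.pi univ fun _ => Ici x).indicator (fun _ => g x) z := by
    intro z
    simp [hF, indicator_apply, Pi.le_def]
  simp_rw [h2]
  rw [integral_indicator_const _ (MeasurableSet.univ_pi fun _ => measurableSet_Ici), measureReal_def,
    Measure.pi_pi, ENNReal.toReal_prod]
  simp [Fintype.card_subtype_compl, measureReal_def]

lemma integral_indicator_isLeastAt_weibullMeasure {E : Type*} [NormedAddCommGroup E]
    [NormedSpace ℝ E] [CompleteSpace E] {k : ℝ} (hk : 0 < k) (a : κ) {g : ℝ → E}
    (hg : Integrable g (weibullMeasure k 1)) :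
    ∫ y, {y : κ → ℝ | IsLeastAt a y}.indicator (fun y => g (y a)) y
        ∂(Measure.pi fun _ => weibullMeasure k 1) =
      (1 / (Fintype.card κ : ℝ)) •
        ∫ x, g ((Fintype.card κ : ℝ) ^ (-(1 / k)) * x) ∂(weibullMeasure k 1) := by
  have := isProbabilityMeasure_weibullMeasure hk
  have hpos : 1 ≤ Fintype.card κ := Fintype.card_pos_iff.2 ⟨a⟩
  rw [integral_indicator_isLeastAt _ a hg, integral_weibullMeasure_Ici_pow_smul hk]
  have : ((Fintype.card κ - 1 : ℕ) : ℝ) + 1 = Fintype.card κ := by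
    rw [Nat.cast_sub hpos]; simp
  rw [this]

lemma measureReal_isLeastAt_weibullMeasure {k : ℝ} (hk : 0 < k) (a : κ) :
    (Measure.pi fun _ : κ => weibullMeasure k 1).real {y : κ → ℝ | IsLeastAt a y} =
      1 / Fintype.card κ := by
  have := isProbabilityMeasure_weibullMeasure hk
  have h := integral_indicator_isLeastAt_weibullMeasure hk a (g := fun _ => (1 : ℝ))
    (integrable_const _)
  rw [integral_indicator_const _ (measurableSet_isLeastAt a)] at h
  simpa using h

/-- A coordinate that is not the least one has expectation at most `E / (card κ - 1)` on the event
that another given coordinate is the least. -/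
lemma integral_indicator_isLeastAt_eval_le {k : ℝ} (hk : 0 < k) {a b : κ} (hab : a ≠ b) :
    ∫ y, {y : κ → ℝ | IsLeastAt a y}.indicator (fun y => y b) y
        ∂(Measure.pi fun _ => weibullMeasure k 1) ≤
      (1 / (Fintype.card κ - 1 : ℝ)) * ∫ x, x ∂(weibullMeasure k 1) := by
  classical
  have := isProbabilityMeasure_weibullMeasure hk
  set ν := weibullMeasure k 1
  have hpair := measurePreserving_eval_prod_compl ν b
  have hid : Integrable (fun x : ℝ => x) ν := by
    simpa using integrable_pow_weibullMeasure hk 1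
  set A : Set ({j // ¬ j = b} → ℝ) := {z | IsLeastAt ⟨a, hab⟩ z}
  have hA : MeasurableSet A := measurableSet_isLeastAt _
  set F : ℝ × ({j // ¬ j = b} → ℝ) → ℝ := fun q => q.1 * A.indicator 1 q.2 with hF
  have hFint : Integrable F (ν.prod (Measure.pi fun _ : {j // ¬ j = b} => ν)) :=
    Integrable.mul_prod hid ((integrable_const (1 : ℝ)).indicator hA)
  have hpos : ∀ᵐ y ∂(Measure.pi fun _ : κ => ν), 0 < y b :=
    (measurePreserving_eval (fun _ : κ => ν) b).quasiMeasurePreserving.ae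
      (ae_pos_weibullMeasure k)
  have hint_b : Integrable (fun y : κ → ℝ => y b) (Measure.pi fun _ : κ => ν) :=
    (measurePreserving_eval (fun _ : κ => ν) b).integrable_comp_of_integrable hid
  calc
    -- Dropping the requirement `y a ≤ y b` enlarges the event to one that involves only the
    -- coordinates other than `b`. It is independent of `y b` and has probability `1 / (card κ -
    -- 1)`.
    _ ≤ ∫ y, F (y b, fun j : {j // ¬ j = b} => y j) ∂(Measure.pi fun _ : κ => ν) := by
      refine integral_mono_ae (hint_b.indicator (measurableSet_isLeastAt a))
        (hpair.integrable_comp_of_integrable hFint) ?_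
      filter_upwards [hpos] with y hy
      simp only [hF, indicator_apply, mem_ofPred_eq, A]
      split_ifs with h1 h2 h2
      · simp
      · exact (h2 fun j => h1 j).elim
      · simpa using hy.le
      · simp
    _ = ∫ q, F q ∂(ν.prod (Measure.pi fun _ : {j // ¬ j = b} => ν)) := by
      rw [← hpair.map_eq, integral_map hpair.measurable.aemeasurable]
      rw [hpair.map_eq]
      exact hFint.aestronglyMeasurable
    _ = (∫ x, x ∂ν) * (1 / (Fintype.card κ - 1 : ℝ)) := by
      rw [hF, integral_prod_mul (fun x : ℝ => x), integral_indicator_one hA,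
        measureReal_isLeastAt_weibullMeasure hk]
      have : 1 ≤ Fintype.card κ := Fintype.card_pos_iff.2 ⟨a⟩
      simp [Fintype.card_subtype_compl, Nat.cast_sub this]
    _ = _ := mul_comm _ _

end Rows

/-! ### Independence of rows -/

/-- Currying identifies the product measure on a sigma type with the iterated product, so an
independent family grouped into rows has independent rows. -/
lemma map_rows_eq_pi {ι : Type*} [Fintype ι] {κ : ι → Type*} [∀ i, Fintype (κ i)]
    {Ω : Type*} [MeasurableSpace Ω] {P : Measure Ω} {ν : Measure ℝ} [IsProbabilityMeasure ν]
    {X : (Σ i, κ i) → Ω → ℝ} (hX : ∀ p, HasLaw (X p) ν P) (hind : iIndepFun X P) :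
    HasLaw (fun ω i j => X ⟨i, j⟩ ω) (Measure.pi fun i => Measure.pi fun _ : κ i => ν) P := by
  have h := hind.hasLaw_pi hX
  have hm := Measure.infinitePi_map_piCurry (X := fun (i : ι) (_ : κ i) => ℝ) (fun _ _ => ν)
  simp only [Measure.infinitePi_eq_pi] at hm
  refine ⟨?_, ?_⟩
  · exact aemeasurable_pi_lambda _ fun i => aemeasurable_pi_lambda _ fun j => (hX _).aemeasurable
  · rw [← hm, ← h.map_eq, AEMeasurable.map_map_of_aemeasurable
      (MeasurableEquiv.measurable _).aemeasurable h.aemeasurable]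
    rfl

lemma integral_prod_rows {𝕜 : Type*} [RCLike 𝕜] {ι : Type*} [Fintype ι] {κ : ι → Type*}
    [∀ i, Fintype (κ i)] {Ω : Type*} [MeasurableSpace Ω] {P : Measure Ω} {ν : Measure ℝ}
    [IsProbabilityMeasure ν] {X : (Σ i, κ i) → Ω → ℝ} (hX : ∀ p, HasLaw (X p) ν P)
    (hind : iIndepFun X P) {h : ∀ i, (κ i → ℝ) → 𝕜} (hh : ∀ i, Measurable (h i)) :
    ∫ ω, ∏ i, h i (fun j => X ⟨i, j⟩ ω) ∂P =
      ∏ i, ∫ y, h i y ∂(Measure.pi fun _ : κ i => ν) := by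
  have hl := map_rows_eq_pi hX hind
  rw [← integral_fintype_prod_eq_prod, ← hl.map_eq, integral_map hl.aemeasurable]
  refine Measurable.aestronglyMeasurable ?_
  fun_prop

/-! ### A central limit theorem for weighted sums -/

lemma charFun_sub_taylor_isLittleO {ν : Measure ℝ} [IsProbabilityMeasure ν] (h2 : MemLp id 2 ν)
    (h0 : ∫ x, x ∂ν = 0) :
    (fun t : ℝ => charFun ν t - (1 - ((∫ x, x ^ 2 ∂ν : ℝ) : ℂ) * t ^ 2 / 2)) =o[𝓝 0]
      fun t : ℝ => t ^ 2 := by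
  have h2' : MemLp id (2 : ℕ) ν := by exact_mod_cast h2
  have ht : ∀ t : ℝ, taylorWithinEval (charFun ν) 2 univ 0 t =
      1 - ((∫ x, x ^ 2 ∂ν : ℝ) : ℂ) * t ^ 2 / 2 := by
    intro t
    have := taylorWithinEval_charFun_two_zero (P := ν) (X := id) aemeasurable_id
      (by simpa using h2) t
    simp only [Measure.map_id, id_eq, h0] at this
    simpa using this
  simp_rw [← ht]
  have := taylor_isLittleO_univ (x₀ := 0) (contDiff_charFun h2')
  simpa using this

/-- The centred Gaussian with the same variance has the same second-order Taylor polynomial at `0`.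
-/
lemma charFun_sub_charFun_gaussianReal_isLittleO {ν : Measure ℝ} [IsProbabilityMeasure ν]
    (h2 : MemLp id 2 ν) (h0 : ∫ x, x ∂ν = 0) :
    (fun t : ℝ => charFun ν t - charFun (gaussianReal 0 (∫ x, x ^ 2 ∂ν).toNNReal) t) =o[𝓝 0]
      fun t : ℝ => t ^ 2 := by
  have hG := charFun_sub_taylor_isLittleO
    (memLp_id_gaussianReal' (μ := 0) (v := (∫ x, x ^ 2 ∂ν).toNNReal) 2 (by simp))
    integral_id_gaussianReal
  have hv : ∫ x, x ^ 2 ∂(gaussianReal 0 (∫ x, x ^ 2 ∂ν).toNNReal) = ∫ x, x ^ 2 ∂ν := by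
    have h := variance_id_gaussianReal (μ := 0) (v := (∫ x, x ^ 2 ∂ν).toNNReal)
    rw [variance_of_integral_eq_zero aemeasurable_id (by simp)] at h
    rw [Real.coe_toNNReal _ (integral_nonneg fun x => sq_nonneg x)] at h
    simpa using h
  rw [hv] at hG
  have := (charFun_sub_taylor_isLittleO h2 h0).sub hG
  simpa using this

/-- Factors are exchanged one at a time; all the others have norm at most `1`. -/
lemma norm_prod_sub_prod_le {ι : Type*} (s : Finset ι) {a b : ι → ℂ} (ha : ∀ i ∈ s, ‖a i‖ ≤ 1)
    (hb : ∀ i ∈ s, ‖b i‖ ≤ 1) : ‖∏ i ∈ s, a i - ∏ i ∈ s, b i‖ ≤ ∑ i ∈ s, ‖a i - b i‖ := by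
  classical
  induction s using Finset.induction_on with
  | empty => simp
  | insert i s hi ih =>
    rw [Finset.prod_insert hi, Finset.prod_insert hi, Finset.sum_insert hi,
      show a i * ∏ j ∈ s, a j - b i * ∏ j ∈ s, b j =
        (a i - b i) * ∏ j ∈ s, a j + b i * (∏ j ∈ s, a j - ∏ j ∈ s, b j) by ring]
    have h1 : ‖∏ j ∈ s, a j‖ ≤ 1 := by
      rw [norm_prod]
      exact Finset.prod_le_one (fun _ _ => norm_nonneg _)
        fun j hj => ha j (Finset.mem_insert_of_mem hj)
    have h2 := ih (fun j hj => ha j (Finset.mem_insert_of_mem hj))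
      fun j hj => hb j (Finset.mem_insert_of_mem hj)
    refine (norm_add_le _ _).trans (add_le_add ?_ ?_)
    · rw [norm_mul]
      exact mul_le_of_le_one_right (norm_nonneg _) h1
    · rw [norm_mul]
      exact (mul_le_of_le_one_left (norm_nonneg _) (hb i (Finset.mem_insert_self i s))).trans h2

/-- Lindeberg's theorem for weighted sums of independent copies of one centred variable, in terms
of characteristic functions. -/
lemma tendsto_prod_charFun_mul {ν : Measure ℝ} [IsProbabilityMeasure ν]
    (h2 : MemLp id 2 ν) (h0 : ∫ x, x ∂ν = 0) {w : ℕ → ℕ → ℝ} {c : ℕ → ℝ} {V : ℝ}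
    (hw : ∀ n m, |w n m| ≤ c n) (hc : Tendsto c atTop (𝓝 0))
    (hV : Tendsto (fun n => ∑ m ∈ Finset.range n, w n m ^ 2) atTop (𝓝 V)) (s : ℝ) :
    Tendsto (fun n => ∏ m ∈ Finset.range n, charFun ν (w n m * s)) atTop
      (𝓝 (charFun (gaussianReal 0 (V * ∫ x, x ^ 2 ∂ν).toNNReal) s)) := by
  set v : ℝ := ∫ x, x ^ 2 ∂ν with hv
  have hv0 : 0 ≤ v := integral_nonneg fun x => sq_nonneg x
  have hV0 : 0 ≤ V := ge_of_tendsto' hV fun n => Finset.sum_nonneg fun m _ => sq_nonneg _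
  have hgauss : Tendsto
      (fun n => ∏ m ∈ Finset.range n, charFun (gaussianReal 0 v.toNNReal) (w n m * s)) atTop
      (𝓝 (charFun (gaussianReal 0 (V * v).toNNReal) s)) := by
    have h1 : ∀ n, ∏ m ∈ Finset.range n, charFun (gaussianReal 0 v.toNNReal) (w n m * s) =
        Complex.exp (-((∑ m ∈ Finset.range n, w n m ^ 2 : ℝ) * (v * s ^ 2 / 2) : ℝ)) := by
      intro n
      simp only [charFun_gaussianReal, ← Complex.exp_sum]
      congr 1
      rw [Real.coe_toNNReal _ hv0, Finset.sum_mul]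
      push_cast
      rw [← Finset.sum_neg_distrib]
      refine Finset.sum_congr rfl fun m _ => ?_
      ring
    simp_rw [h1]
    have h3 : charFun (gaussianReal 0 (V * v).toNNReal) s =
        Complex.exp (-(V * (v * s ^ 2 / 2) : ℝ)) := by
      rw [charFun_gaussianReal, Real.coe_toNNReal _ (by positivity)]
      congr 1
      push_cast
      ring
    rw [h3]
    have h4 : Continuous fun x : ℝ => Complex.exp (-(x * (v * s ^ 2 / 2) : ℝ)) := by fun_prop
    exact (h4.tendsto V).comp hV
  have hdiff : Tendsto (fun n => ∏ m ∈ Finset.range n, charFun ν (w n m * s) -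
      ∏ m ∈ Finset.range n, charFun (gaussianReal 0 v.toNNReal) (w n m * s)) atTop (𝓝 0) := by
    rw [Metric.tendsto_atTop]
    intro ε hε
    -- The sum of squared weights is eventually below `V + 1`, and the final `+ 1` keeps the
    -- denominator positive at `s = 0` and makes the last inequality strict.
    have hB : 0 < (V + 1) * s ^ 2 + 1 := by positivity
    have ho := (charFun_sub_charFun_gaussianReal_isLittleO h2 h0).def
      (c := ε / ((V + 1) * s ^ 2 + 1)) (by positivity)
    obtain ⟨δ, hδ, ho⟩ := Metric.eventually_nhds_iff.1 ho
    have hcs : Tendsto (fun n => c n * |s|) atTop (𝓝 0) := by simpa using hc.mul_const |s|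
    have hev : ∀ᶠ n in atTop, c n * |s| < δ ∧ ∑ m ∈ Finset.range n, w n m ^ 2 < V + 1 :=
      (hcs.eventually_lt_const hδ).and (hV.eventually_lt_const (by linarith))
    obtain ⟨n₀, hn₀⟩ := eventually_atTop.1 hev
    refine ⟨n₀, fun n hn => ?_⟩
    obtain ⟨hn1, hn2⟩ := hn₀ n hn
    rw [dist_zero_right]
    calc _ ≤ ∑ m ∈ Finset.range n, ‖charFun ν (w n m * s) -
          charFun (gaussianReal 0 v.toNNReal) (w n m * s)‖ :=
          norm_prod_sub_prod_le _ (fun _ _ => norm_charFun_le_one _)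
            fun _ _ => norm_charFun_le_one _
      _ ≤ ∑ m ∈ Finset.range n, ε / ((V + 1) * s ^ 2 + 1) * (w n m ^ 2 * s ^ 2) := by
          refine Finset.sum_le_sum fun m _ => ?_
          have := ho (y := w n m * s) (by
            rw [dist_zero_right, Real.norm_eq_abs, abs_mul]
            exact (mul_le_mul_of_nonneg_right (hw n m) (abs_nonneg s)).trans_lt hn1)
          rwa [norm_pow, Real.norm_eq_abs, sq_abs, mul_pow] at this
      _ = ε / ((V + 1) * s ^ 2 + 1) * ((∑ m ∈ Finset.range n, w n m ^ 2) * s ^ 2) := by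
          rw [← Finset.mul_sum, Finset.sum_mul]
      _ ≤ ε / ((V + 1) * s ^ 2 + 1) * ((V + 1) * s ^ 2) := by gcongr
      _ < ε := by
          rw [div_mul_eq_mul_div, div_lt_iff₀ hB]
          nlinarith
  have := hdiff.add hgauss
  simpa using this

/-! ### Centring and perturbation through characteristic functions -/

lemma charFun_map_pi_sum {ι : Type*} [Fintype ι] (ν : Measure ℝ) [IsProbabilityMeasure ν]
    {f : ι → ℝ → ℝ} (hf : ∀ i, Measurable (f i)) (s : ℝ) :
    charFun ((Measure.pi fun _ : ι => ν).map fun y => ∑ i, f i (y i)) s =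
      ∏ i, charFun (ν.map (f i)) s := by
  have hind := iIndepFun_pi (μ := fun _ : ι => ν) (X := f) fun i => (hf i).aemeasurable
  have h := congrFun (hind.charFun_map_fun_sum_eq_prod
    fun i => ((hf i).comp (measurable_pi_apply i)).aemeasurable) s
  rw [Finset.prod_apply] at h
  refine h.trans ?_
  refine Finset.prod_congr rfl fun i _ => ?_
  have : ν = (Measure.pi fun _ : ι => ν).map (Function.eval i) :=
    ((measurePreserving_eval (fun _ : ι => ν) i).map_eq).symm
  conv_rhs => rw [this, Measure.map_map (hf i) (measurable_pi_apply i)]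

/-- A law with the characteristic function of a weighted sum of independent copies has the
corresponding mean, and after centring the corresponding characteristic function. -/
lemma integral_eq_and_charFun_of_charFun_eq {ι : Type*} [Fintype ι] {ν : Measure ℝ}
    [IsProbabilityMeasure ν] (h1 : Integrable id ν) {b : ι → ℝ} {ρ : Measure ℝ}
    [IsProbabilityMeasure ρ] (hρ : ∀ s, charFun ρ s = ∏ i, charFun ν (b i * s)) :
    Integrable id ρ ∧ ∀ c s, charFun (ρ.map fun x => (x - ∫ y, y ∂ρ) / c) s =
      ∏ i, charFun (ν.map fun x => x - ∫ y, y ∂ν) (b i / c * s) := by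
  set μ := Measure.pi fun _ : ι => ν
  have hmeas : Measurable fun y : ι → ℝ => ∑ i, b i * y i := by fun_prop
  -- Characteristic functions determine laws, so `ρ` may be realised as a weighted sum on a product
  -- space, where the mean and the centring are computed term by term.
  have hρμ : ρ = μ.map fun y => ∑ i, b i * y i := by
    have : IsProbabilityMeasure (μ.map fun y => ∑ i, b i * y i) :=
      Measure.isProbabilityMeasure_map hmeas.aemeasurable
    refine Measure.ext_of_charFun ?_
    ext s
    rw [hρ, charFun_map_pi_sum ν (f := fun i x => b i * x) (fun i => by fun_prop)]
    exact Finset.prod_congr rfl fun i _ => (charFun_map_mul (b i) s).symm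
  have hi : ∀ i, Integrable (fun y : ι → ℝ => y i) μ := fun i =>
    (measurePreserving_eval (fun _ : ι => ν) i).integrable_comp_of_integrable h1
  have hmean : ∫ y, y ∂ρ = ∑ i, b i * ∫ y, y ∂ν := by
    rw [hρμ, integral_map hmeas.aemeasurable (by fun_prop),
      integral_finsetSum _ fun i _ => (hi i).const_mul _]
    refine Finset.sum_congr rfl fun i _ => ?_
    rw [integral_const_mul]
    congr 1
    have := (measurePreserving_eval (fun _ : ι => ν) i).map_eq
    conv_rhs => rw [← this]
    rw [integral_map (measurable_pi_apply i).aemeasurable (by fun_prop)]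
  constructor
  · rw [hρμ, integrable_map_measure (by fun_prop) hmeas.aemeasurable]
    exact integrable_finsetSum _ fun i _ => (hi i).const_mul _
  · intro c s
    rw [hmean, hρμ, Measure.map_map (by fun_prop) hmeas]
    have h : ((fun x => (x - ∑ i, b i * ∫ y, y ∂ν) / c) ∘ fun y : ι → ℝ => ∑ i, b i * y i) =
        fun y => ∑ i, b i / c * (y i - ∫ y, y ∂ν) := by
      ext y
      simp only [Function.comp_apply]
      rw [← Finset.sum_sub_distrib, Finset.sum_div]
      exact Finset.sum_congr rfl fun i _ => by ring
    rw [h, charFun_map_pi_sum ν (f := fun i x => b i / c * (x - ∫ y, y ∂ν))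
      (fun i => by fun_prop)]
    refine Finset.prod_congr rfl fun i _ => ?_
    rw [← charFun_map_mul, Measure.map_map (by fun_prop) (by fun_prop)]
    rfl

/-- From `|exp (i x) - 1| ≤ |x|`. It turns an `L¹`-small perturbation, such as the rescaled closing
edge, into a small change of the characteristic function. -/
lemma norm_charFun_map_sub_charFun_map_le {Ω : Type*} [MeasurableSpace Ω] {P : Measure Ω}
    [IsProbabilityMeasure P] {X Y : Ω → ℝ} (hX : Integrable X P) (hY : Integrable Y P) (s : ℝ) :
    ‖charFun (P.map X) s - charFun (P.map Y) s‖ ≤ |s| * ∫ ω, |X ω - Y ω| ∂P := by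
  have hi : ∀ {Z : Ω → ℝ}, Integrable Z P →
      Integrable (fun ω => Complex.exp (s * Z ω * Complex.I)) P := fun {Z} hZ => by
    refine Integrable.of_bound (C := 1) ?_ (ae_of_all _ fun ω => ?_)
    · have := hZ.aestronglyMeasurable.aemeasurable
      refine AEMeasurable.aestronglyMeasurable ?_
      fun_prop
    · rw [← Complex.ofReal_mul, Complex.norm_exp_ofReal_mul_I]
  rw [charFun_apply_real, charFun_apply_real,
    integral_map hX.aestronglyMeasurable.aemeasurable (by fun_prop),
    integral_map hY.aestronglyMeasurable.aemeasurable (by fun_prop),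
    ← integral_sub (hi hX) (hi hY), ← integral_const_mul]
  refine norm_integral_le_of_norm_le ((hX.sub hY).abs.const_mul _) (ae_of_all _ fun ω => ?_)
  have h : Complex.exp (s * X ω * Complex.I) - Complex.exp (s * Y ω * Complex.I) =
      Complex.exp ((s * Y ω : ℝ) * Complex.I) *
        (Complex.exp (Complex.I * (s * (X ω - Y ω) : ℝ)) - 1) := by
    rw [mul_sub, ← Complex.exp_add, mul_one]
    push_cast
    congr 2
    ring
  rw [h, norm_mul, Complex.norm_exp_ofReal_mul_I, one_mul]
  refine Real.norm_exp_I_mul_ofReal_sub_one_le.trans ?_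
  rw [Real.norm_eq_abs, abs_mul]

section Edges

/-! ### Nearest neighbour tours -/

/-- The edge between two distinct cities. -/
def edgeOf {n : ℕ} (i j : Fin n) (h : i ≠ j) : Edge n :=
  if hij : i < j then ⟨(i, j), hij⟩ else ⟨(j, i), lt_of_le_of_ne (not_lt.1 hij) h.symm⟩

lemma cityDist_eq_edgeOf {n : ℕ} (l : Edge n → ℝ) {i j : Fin n} (h : i ≠ j) :
    cityDist l i j = l (edgeOf i j h) := by
  unfold cityDist edgeOf
  split_ifs with h1 h2
  · rfl
  · rfl
  · exact absurd (le_antisymm (not_lt.1 h2) (not_lt.1 h1)) h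

lemma cityDist_comm {n : ℕ} (l : Edge n → ℝ) (i j : Fin n) : cityDist l i j = cityDist l j i := by
  unfold cityDist
  rcases lt_trichotomy i j with h | h | h
  · simp [h, h.not_gt]
  · simp [h]
  · simp [h, h.not_gt]

lemma edgeOf_eq_edgeOf {n : ℕ} {i j i' j' : Fin n} {h : i ≠ j} {h' : i' ≠ j'}
    (he : edgeOf i j h = edgeOf i' j' h') : i = i' ∧ j = j' ∨ i = j' ∧ j = i' := by
  unfold edgeOf at he
  split_ifs at he <;> simp only [Subtype.mk.injEq, Prod.mk.injEq] at he <;> tauto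

lemma measurable_cityDist {n : ℕ} (i j : Fin n) :
    Measurable fun l : Edge n → ℝ => cityDist l i j := by
  unfold cityDist
  split_ifs <;> fun_prop

variable {N : ℕ}

/-- The edges of the complete graph, arranged in rows by the tour `σ`: row `i` holds the edges from
the `i`-th city of the tour to the later cities. -/
def tourEdge (σ : Equiv.Perm (Fin (N + 1))) (p : Σ i : Fin N, {t : Fin N // i ≤ t}) :
    Edge (N + 1) :=
  edgeOf (σ p.1.castSucc) (σ p.2.1.succ) <| σ.injective.ne <| ne_of_lt <|
    Fin.castSucc_lt_succ_iff.2 p.2.2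

/-- Distinct entries of the rows are distinct edges, which is what makes the rows independent. Two
entries cannot be the same edge with its ends exchanged, because the first end always comes earlier
on the tour. -/
lemma tourEdge_injective (σ : Equiv.Perm (Fin (N + 1))) : Function.Injective (tourEdge σ) := by
  rintro ⟨i, t, hit⟩ ⟨i', t', hit'⟩ h
  rcases edgeOf_eq_edgeOf h with ⟨h1, h2⟩ | ⟨h1, h2⟩
  · have h1' := Fin.castSucc_injective _ (σ.injective h1)
    have h3 := Fin.succ_injective _ (σ.injective h2)
    dsimp only at h1' h3
    subst h1' h3
    rfl
  · have h1 := congrArg Fin.val (σ.injective h1)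
    have h2 := congrArg Fin.val (σ.injective h2)
    simp only [Fin.val_castSucc, Fin.val_succ] at h1 h2
    rw [Fin.le_def] at hit hit'
    omega

/-- The length of the open path `σ 0, …, σ N`. -/
def pathLength (l : Edge (N + 1) → ℝ) (σ : Equiv.Perm (Fin (N + 1))) : ℝ :=
  ∑ i : Fin N, l (tourEdge σ ⟨i, i, le_rfl⟩)

lemma tourLength_eq_pathLength_add (l : Edge (N + 1) → ℝ) (σ : Equiv.Perm (Fin (N + 1))) :
    tourLength (cityDist l) σ = pathLength l σ + cityDist l (σ 0) (σ (Fin.last N)) := by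
  unfold tourLength pathLength
  rw [Fin.sum_univ_castSucc]
  congr 1
  · refine Finset.sum_congr rfl fun i _ => ?_
    rw [finRotate_of_lt (by simp)]
    exact cityDist_eq_edgeOf l _
  · rw [finRotate_last, cityDist_comm]

/-- The distances for which `σ` is a nearest neighbour tour. -/
def tourSet (σ : Equiv.Perm (Fin (N + 1))) : Set (Edge (N + 1) → ℝ) :=
  {l | IsNNTour (cityDist l) σ}

/-- The unvisited cities after step `i` are the `σ w` with `w > i`. Column `t` stands for `σ (t +
1)`, so the diagonal entry `t = i` is the edge to the next city. -/
lemma mem_tourSet_iff {σ : Equiv.Perm (Fin (N + 1))} {l : Edge (N + 1) → ℝ} :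
    l ∈ tourSet σ ↔ σ 0 = 0 ∧ ∀ i : Fin N, IsLeastAt (⟨i, le_rfl⟩ : {t : Fin N // i ≤ t})
      (fun t => l (tourEdge σ ⟨i, t⟩)) := by
  simp only [tourEdge, IsLeastAt, ← cityDist_eq_edgeOf]
  constructor
  · intro h
    refine ⟨h.start 0 rfl, fun i t => h.nearest _ _ (by simp) _ fun k hk => σ.injective.ne ?_⟩
    have := t.2
    rw [Fin.le_def] at hk this
    intro he
    have he := congrArg Fin.val he
    simp at he hk
    omega
  · rintro ⟨h0, h⟩
    refine ⟨fun i hi => ?_, fun i j hij u hu => ?_⟩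
    · rw [show i = 0 from Fin.ext hi, h0]
    · have hiN : i.val < N := by omega
      obtain ⟨w, rfl⟩ := σ.surjective u
      have hw : i < w := by
        by_contra hcon
        exact hu w (not_lt.1 hcon) rfl
      rw [Fin.lt_def] at hw
      have hw0 : w ≠ 0 := fun h => by simp [h] at hw
      have hsucc : (w.pred hw0).succ = w := Fin.succ_pred w hw0
      have := h ⟨i, hiN⟩ ⟨w.pred hw0, by rw [Fin.le_def]; simp; omega⟩
      have hj : (⟨i, hiN⟩ : Fin N).succ = j := Fin.ext (by simp [hij])
      have hi : (⟨i, hiN⟩ : Fin N).castSucc = i := Fin.ext (by simp)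
      simp only [hj, hi, hsucc] at this
      exact this

lemma measurableSet_tourSet (σ : Equiv.Perm (Fin (N + 1))) : MeasurableSet (tourSet σ) := by
  have : tourSet σ = {l | σ 0 = 0 ∧ ∀ i : Fin N, (fun t => l (tourEdge σ ⟨i, t⟩)) ∈
      {y | IsLeastAt (⟨i, le_rfl⟩ : {t : Fin N // i ≤ t}) y}} := by
    ext l
    exact mem_tourSet_iff
  rw [this]
  refine (MeasurableSet.const _).inter ?_
  have : {l : Edge (N + 1) → ℝ | ∀ i : Fin N, (fun t => l (tourEdge σ ⟨i, t⟩)) ∈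
      {y | IsLeastAt (⟨i, le_rfl⟩ : {t : Fin N // i ≤ t}) y}} =
      ⋂ i : Fin N, (fun l t => l (tourEdge σ ⟨i, t⟩)) ⁻¹'
        {y | IsLeastAt (⟨i, le_rfl⟩ : {t : Fin N // i ≤ t}) y} := by
    ext
    simp
  change MeasurableSet {l : Edge (N + 1) → ℝ | ∀ i : Fin N, (fun t => l (tourEdge σ ⟨i, t⟩)) ∈
      {y | IsLeastAt (⟨i, le_rfl⟩ : {t : Fin N // i ≤ t}) y}}
  rw [this]
  refine MeasurableSet.iInter fun i => ?_
  exact (measurableSet_isLeastAt _).preimage (by fun_prop)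

lemma tourSet_eq_empty {σ : Equiv.Perm (Fin (N + 1))} (h : σ 0 ≠ 0) : tourSet σ = ∅ :=
  eq_empty_of_forall_notMem fun _ hl => h (mem_tourSet_iff.1 hl).1

lemma measurable_pathLength (σ : Equiv.Perm (Fin (N + 1))) :
    Measurable fun l : Edge (N + 1) → ℝ => pathLength l σ := by
  unfold pathLength
  fun_prop

lemma card_row (i : Fin N) : Fintype.card {t : Fin N // i ≤ t} = N - i := by
  rw [Fintype.card_subtype, ← Fin.card_Ici i]
  congr 1
  ext
  simp

/-- Permutations fixing `0` correspond to permutations of the remaining `N` elements. -/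
lemma card_filter_perm_map_zero :
    (Finset.univ.filter fun σ : Equiv.Perm (Fin (N + 1)) => σ 0 = 0).card = N.factorial := by
  have : (Finset.univ.filter fun σ : Equiv.Perm (Fin (N + 1)) => σ 0 = 0) =
      Finset.univ.map ⟨fun e : Equiv.Perm (Fin N) => Equiv.Perm.decomposeFin.symm (0, e),
        fun e e' h => by simpa using h⟩ := by
    ext σ
    simp only [Finset.mem_filter, Finset.mem_univ, true_and, Finset.mem_map]
    constructor
    · intro h
      refine ⟨(Equiv.Perm.decomposeFin σ).2, ?_⟩
      have h2 : (Equiv.Perm.decomposeFin σ).1 = 0 := by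
        have := Equiv.Perm.decomposeFin_symm_apply_zero (Equiv.Perm.decomposeFin σ).1
          (Equiv.Perm.decomposeFin σ).2
        rw [← this]
        simpa using h
      change Equiv.Perm.decomposeFin.symm (0, (Equiv.Perm.decomposeFin σ).2) = σ
      rw [← h2]
      simp
    · rintro ⟨e, rfl⟩
      change Equiv.Perm.decomposeFin.symm (0, e) 0 = 0
      simp
  rw [this, Finset.card_map, Finset.card_univ, Fintype.card_perm, Fintype.card_fin]

lemma prod_one_div_sub_eq (N : ℕ) :
    ∏ i : Fin N, (1 / ((N - i : ℕ) : ℝ)) = 1 / (N.factorial : ℝ) := by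
  rw [Fin.prod_univ_eq_prod_range (fun i => 1 / ((N - i : ℕ) : ℝ)) N,
    ← Finset.prod_range_add_one_eq_factorial]
  simp_rw [one_div, Finset.prod_inv_distrib, ← Nat.cast_prod]
  congr 2
  rw [← Finset.prod_range_reflect (fun x => x + 1)]
  refine Finset.prod_congr rfl fun i hi => ?_
  have := Finset.mem_range.1 hi
  omega

/-! ### Expectations over the edge lengths -/

/-- The joint law of independent Weibull edge lengths. -/
def edgeLaw (n : ℕ) (k : ℝ) : Measure (Edge n → ℝ) := Measure.pi fun _ => weibullMeasure k 1

lemma isProbabilityMeasure_edgeLaw (n : ℕ) {k : ℝ} (hk : 0 < k) :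
    IsProbabilityMeasure (edgeLaw n k) := by
  have := isProbabilityMeasure_weibullMeasure hk
  unfold edgeLaw
  infer_instance

lemma integral_prod_tour_rows {𝕜 : Type*} [RCLike 𝕜] {k : ℝ} (hk : 0 < k)
    (σ : Equiv.Perm (Fin (N + 1))) {h : ∀ i : Fin N, ({t : Fin N // i ≤ t} → ℝ) → 𝕜}
    (hh : ∀ i, Measurable (h i)) :
    ∫ l, ∏ i, h i (fun t => l (tourEdge σ ⟨i, t⟩)) ∂(edgeLaw (N + 1) k) =
      ∏ i, ∫ y, h i y ∂(Measure.pi fun _ => weibullMeasure k 1) := by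
  have := isProbabilityMeasure_weibullMeasure hk
  refine integral_prod_rows (P := edgeLaw (N + 1) k)
    (X := fun p (l : Edge (N + 1) → ℝ) => l (tourEdge σ p)) (fun p => ?_) ?_ hh
  · exact ⟨(measurable_pi_apply _).aemeasurable, (measurePreserving_eval (fun _ => weibullMeasure k 1) _).map_eq⟩
  · exact (iIndepFun_pi (μ := fun _ : Edge (N + 1) => weibullMeasure k 1) (X := fun _ x => x)
      (fun _ => aemeasurable_id)).precomp (tourEdge_injective σ)

/-- The indicator of the tour event is the product of the row indicators, so the integral splits
into one least-entry integral per row. The result does not depend on `σ`. -/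
lemma integral_tourSet_indicator_prod {𝕜 : Type*} [RCLike 𝕜] {k : ℝ} (hk : 0 < k)
    {σ : Equiv.Perm (Fin (N + 1))} (hσ : σ 0 = 0) {g : Fin N → ℝ → 𝕜}
    (hg : ∀ i, Measurable (g i)) (hgi : ∀ i, Integrable (g i) (weibullMeasure k 1)) :
    ∫ l, (tourSet σ).indicator (fun l => ∏ i, g i (l (tourEdge σ ⟨i, i, le_rfl⟩))) l
        ∂(edgeLaw (N + 1) k) =
      ∏ i : Fin N, (1 / ((N - i : ℕ) : ℝ)) •
        ∫ x, g i (((N - i : ℕ) : ℝ) ^ (-(1 / k)) * x) ∂(weibullMeasure k 1) := by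
  classical
  have h1 : ∀ l : Edge (N + 1) → ℝ,
      (tourSet σ).indicator (fun l => ∏ i, g i (l (tourEdge σ ⟨i, i, le_rfl⟩))) l =
      ∏ i, {y | IsLeastAt (⟨i, le_rfl⟩ : {t : Fin N // i ≤ t}) y}.indicator
        (fun y => g i (y ⟨i, le_rfl⟩)) (fun t => l (tourEdge σ ⟨i, t⟩)) := by
    intro l
    simp only [indicator_apply, mem_tourSet_iff, mem_ofPred_eq, hσ, true_and]
    rw [Finset.prod_ite_zero]
    simp
  simp_rw [h1]
  rw [integral_prod_tour_rows hk σ (h := fun i =>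
    {y | IsLeastAt (⟨i, le_rfl⟩ : {t : Fin N // i ≤ t}) y}.indicator fun y => g i (y ⟨i, le_rfl⟩))]
  · refine Finset.prod_congr rfl fun i _ => ?_
    rw [integral_indicator_isLeastAt_weibullMeasure hk _ (hgi i), card_row]
  · intro i
    refine Measurable.indicator ?_ (measurableSet_isLeastAt _)
    exact (hg i).comp (measurable_pi_apply _)

lemma measureReal_tourSet {k : ℝ} (hk : 0 < k) {σ : Equiv.Perm (Fin (N + 1))} (hσ : σ 0 = 0) :
    (edgeLaw (N + 1) k).real (tourSet σ) = 1 / (N.factorial : ℝ) := by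
  have := isProbabilityMeasure_weibullMeasure hk
  have h := integral_tourSet_indicator_prod (𝕜 := ℝ) hk hσ (g := fun _ _ => 1)
    (fun _ => measurable_const) (fun _ => integrable_const _)
  simp only [Finset.prod_const_one] at h
  rw [integral_indicator_const _ (measurableSet_tourSet σ)] at h
  simp only [smul_eq_mul, mul_one, integral_const, probReal_univ] at h
  rw [h, prod_one_div_sub_eq]

/-- Almost surely the nearest neighbour tour is unique. -/
lemma ae_sum_indicator_tourSet_eq_one {k : ℝ} (hk : 0 < k)
    (hex : ∀ᵐ l ∂(edgeLaw (N + 1) k), ∃ σ, l ∈ tourSet (N := N) σ) :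
    ∀ᵐ l ∂(edgeLaw (N + 1) k), ∑ σ, (tourSet (N := N) σ).indicator (fun _ => (1 : ℝ)) l = 1 := by
  have := isProbabilityMeasure_edgeLaw (N + 1) hk
  have hi : ∀ σ, Integrable ((tourSet (N := N) σ).indicator (fun _ => (1 : ℝ))) (edgeLaw (N + 1) k) :=
    fun σ => (integrable_const (1 : ℝ)).indicator (measurableSet_tourSet σ)
  have hsum : Integrable (fun l => ∑ σ, (tourSet (N := N) σ).indicator (fun _ => (1 : ℝ)) l)
      (edgeLaw (N + 1) k) := integrable_finsetSum _ fun σ _ => hi σ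
  have hint : ∫ l, ∑ σ, (tourSet (N := N) σ).indicator (fun _ => (1 : ℝ)) l ∂(edgeLaw (N + 1) k) = 1 := by
    rw [integral_finsetSum _ fun σ _ => hi σ]
    have : ∀ σ : Equiv.Perm (Fin (N + 1)),
        ∫ l, (tourSet σ).indicator (fun _ => (1 : ℝ)) l ∂(edgeLaw (N + 1) k) =
        if σ 0 = 0 then 1 / (N.factorial : ℝ) else 0 := by
      intro σ
      rw [integral_indicator_const _ (measurableSet_tourSet σ), smul_eq_mul, mul_one]
      split_ifs with h
      · exact measureReal_tourSet hk h
      · simp [tourSet_eq_empty h]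
    simp_rw [this]
    rw [← Finset.sum_filter, Finset.sum_const, card_filter_perm_map_zero, nsmul_eq_mul]
    field_simp
  have hle : ∀ᵐ l ∂(edgeLaw (N + 1) k),
      1 ≤ ∑ σ, (tourSet (N := N) σ).indicator (fun _ => (1 : ℝ)) l := by
    filter_upwards [hex] with l ⟨σ, hσ⟩
    calc (1 : ℝ) = (tourSet σ).indicator (fun _ => (1 : ℝ)) l := by simp [hσ]
      _ ≤ _ := Finset.single_le_sum (f := fun σ => (tourSet σ).indicator (fun _ => (1 : ℝ)) l)
        (fun _ _ => indicator_nonneg (fun _ _ => (zero_le_one : (0 : ℝ) ≤ 1)) _) (Finset.mem_univ σ)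
  -- The number of nearest neighbour tours is almost surely at least `1` and has mean `N! / N! = 1`,
  -- hence it is almost surely equal to `1`.
  have h0 : (fun l => ∑ σ, (tourSet (N := N) σ).indicator (fun _ => (1 : ℝ)) l - 1)
      =ᵐ[edgeLaw (N + 1) k] 0 := by
    rw [← integral_eq_zero_iff_of_nonneg_ae]
    · rw [integral_sub hsum (integrable_const _), hint]
      simp
    · filter_upwards [hle] with l hl
      simpa using hl
    · exact hsum.sub (integrable_const _)
  filter_upwards [h0] with l hl
  simpa [sub_eq_zero] using hl

/-- The sum of `F l σ` over the nearest neighbour tours `σ` for the distances `l`. -/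
def tourSum {E : Type*} [AddCommMonoid E] (F : (Edge (N + 1) → ℝ) → Equiv.Perm (Fin (N + 1)) → E)
    (l : Edge (N + 1) → ℝ) : E :=
  ∑ σ, (tourSet σ).indicator (fun l => F l σ) l

lemma tourSum_eq {E : Type*} [AddCommMonoid E]
    (F : (Edge (N + 1) → ℝ) → Equiv.Perm (Fin (N + 1)) → E) {l : Edge (N + 1) → ℝ}
    (hl : ∑ σ, (tourSet (N := N) σ).indicator (fun _ => (1 : ℝ)) l = 1)
    {σ : Equiv.Perm (Fin (N + 1))} (hσ : l ∈ tourSet σ) : tourSum F l = F l σ := by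
  unfold tourSum
  rw [Finset.sum_eq_single_of_mem σ (Finset.mem_univ σ), indicator_of_mem hσ]
  intro τ _ hτ
  refine indicator_of_notMem (fun hmem => ?_) _
  -- A second tour `τ` would make the count at least `2`.
  have h2 : ∑ ρ ∈ {σ, τ}, (tourSet (N := N) ρ).indicator (fun _ => (1 : ℝ)) l ≤ 1 := by
    refine le_of_le_of_eq ?_ hl
    exact Finset.sum_le_sum_of_subset_of_nonneg (s := {σ, τ}) (Finset.subset_univ _)
      fun _ _ _ => indicator_nonneg (fun _ _ => (zero_le_one : (0 : ℝ) ≤ 1)) _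
  rw [Finset.sum_pair hτ.symm] at h2
  simp [hσ, hmem] at h2
  linarith

lemma measurable_tourSum {E : Type*} [AddCommMonoid E] [MeasurableSpace E] [MeasurableAdd₂ E]
    {F : (Edge (N + 1) → ℝ) → Equiv.Perm (Fin (N + 1)) → E} (hF : ∀ σ, Measurable fun l => F l σ) :
    Measurable (tourSum F) := by
  unfold tourSum
  exact Finset.measurable_sum _ fun σ _ => (hF σ).indicator (measurableSet_tourSet σ)

lemma integrable_tourSum {E : Type*} [NormedAddCommGroup E] [NormedSpace ℝ E] {k : ℝ}
    {F : (Edge (N + 1) → ℝ) → Equiv.Perm (Fin (N + 1)) → E}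
    (hF : ∀ σ, Integrable (fun l => F l σ) (edgeLaw (N + 1) k)) :
    Integrable (tourSum F) (edgeLaw (N + 1) k) := by
  unfold tourSum
  exact integrable_finsetSum _ fun σ _ => (hF σ).indicator (measurableSet_tourSet σ)

lemma integrable_eval_edgeLaw {n : ℕ} {k : ℝ} (hk : 0 < k) (e : Edge n) :
    Integrable (fun l => l e) (edgeLaw n k) := by
  have := isProbabilityMeasure_weibullMeasure hk
  have h : Integrable (fun x : ℝ => x) (weibullMeasure k 1) := by
    simpa using integrable_pow_weibullMeasure hk 1
  exact (measurePreserving_eval (fun _ : Edge n => weibullMeasure k 1) e).integrable_comp_of_integrable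
    h

lemma integrable_pathLength {k : ℝ} (hk : 0 < k) (σ : Equiv.Perm (Fin (N + 1))) :
    Integrable (fun l => pathLength l σ) (edgeLaw (N + 1) k) := by
  unfold pathLength
  exact integrable_finsetSum _ fun i _ => integrable_eval_edgeLaw hk _

lemma integrable_cityDist {n : ℕ} {k : ℝ} (hk : 0 < k) (i j : Fin n) :
    Integrable (fun l => cityDist l i j) (edgeLaw n k) := by
  unfold cityDist
  split_ifs
  · exact integrable_eval_edgeLaw hk _
  · exact integrable_eval_edgeLaw hk _
  · exact integrable_zero _ _ _

/-- The characteristic function of the length of the open nearest neighbour path. -/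
lemma charFun_map_tourSum_pathLength {k : ℝ} (hk : 0 < k)
    (hex : ∀ᵐ l ∂(edgeLaw (N + 1) k), ∃ σ, l ∈ tourSet (N := N) σ) (s : ℝ) :
    charFun ((edgeLaw (N + 1) k).map (tourSum pathLength)) s =
      ∏ i : Fin N, charFun (weibullMeasure k 1) (((N - i : ℕ) : ℝ) ^ (-(1 / k)) * s) := by
  have := isProbabilityMeasure_weibullMeasure hk
  have := isProbabilityMeasure_edgeLaw (N + 1) hk
  have hmeas : Measurable (tourSum (N := N) pathLength) := measurable_tourSum measurable_pathLength
  set G : ℝ → ℂ := fun x => Complex.exp (s * x * Complex.I) with hG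
  have hGm : Measurable G := by fun_prop
  have hGb : ∀ x, ‖G x‖ ≤ 1 := fun x => by
    rw [hG]
    dsimp only
    rw [← Complex.ofReal_mul, Complex.norm_exp_ofReal_mul_I]
  have hGi : ∀ {μ : Measure ℝ} [IsProbabilityMeasure μ], Integrable G μ := fun {μ} _ =>
    Integrable.of_bound hGm.aestronglyMeasurable 1 (ae_of_all _ hGb)
  rw [charFun_apply_real, integral_map hmeas.aemeasurable (by fun_prop)]
  have h1 : ∀ᵐ l ∂(edgeLaw (N + 1) k), Complex.exp (s * (tourSum pathLength l : ℝ) * Complex.I) =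
      tourSum (fun l σ => ∏ i : Fin N, G (l (tourEdge σ ⟨i, i, le_rfl⟩))) l := by
    filter_upwards [hex, ae_sum_indicator_tourSet_eq_one hk hex] with l ⟨σ, hσ⟩ hl
    rw [tourSum_eq _ hl hσ, tourSum_eq _ hl hσ, pathLength, hG, ← Complex.exp_sum]
    push_cast
    rw [Finset.mul_sum, Finset.sum_mul]
  rw [integral_congr_ae h1]
  unfold tourSum
  rw [integral_finsetSum]
  -- All `N!` permutations fixing `0` contribute the same amount, and the probability `1 / N!`
  -- cancels their number.
  · have h2 : ∀ σ : Equiv.Perm (Fin (N + 1)),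
        ∫ l, (tourSet σ).indicator (fun l => ∏ i : Fin N, G (l (tourEdge σ ⟨i, i, le_rfl⟩))) l
          ∂(edgeLaw (N + 1) k) =
        if σ 0 = 0 then ((1 / (N.factorial : ℝ) : ℝ) : ℂ) *
          ∏ i : Fin N, charFun (weibullMeasure k 1) (((N - i : ℕ) : ℝ) ^ (-(1 / k)) * s)
        else 0 := by
      intro σ
      split_ifs with hσ
      · rw [integral_tourSet_indicator_prod hk hσ (g := fun _ => G) (fun _ => hGm) (fun _ => hGi),
          ← prod_one_div_sub_eq, Complex.ofReal_prod, ← Finset.prod_mul_distrib]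
        refine Finset.prod_congr rfl fun i _ => ?_
        rw [Complex.real_smul, charFun_apply_real]
        congr 2 with x
        rw [hG]
        push_cast
        congr 1
        ring
      · simp [tourSet_eq_empty hσ]
    simp_rw [h2]
    rw [← Finset.sum_filter, Finset.sum_const, card_filter_perm_map_zero, nsmul_eq_mul]
    push_cast
    rw [← mul_assoc, mul_one_div_cancel (by exact_mod_cast N.factorial_ne_zero), one_mul]
  · intro σ _
    refine Integrable.indicator ?_ (measurableSet_tourSet σ)
    refine Integrable.of_bound (Measurable.aestronglyMeasurable (by fun_prop)) 1
      (ae_of_all _ fun l => ?_)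
    rw [norm_prod]
    exact Finset.prod_le_one (fun _ _ => norm_nonneg _) fun _ _ => hGb _

/-- The expected length of the edge that closes the nearest neighbour tour is bounded. -/
lemma integral_tourSum_cityDist_le {k : ℝ} (hk : 0 < k) (M : ℕ) :
    ∫ l, tourSum (N := M + 2) (fun l σ => cityDist l (σ 0) (σ (Fin.last (M + 2)))) l
      ∂(edgeLaw (M + 3) k) ≤ 2 * ∫ x, x ∂(weibullMeasure k 1) := by
  classical
  have := isProbabilityMeasure_weibullMeasure hk
  have hE : 0 ≤ ∫ x, x ∂(weibullMeasure k 1) :=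
    integral_nonneg_of_ae ((ae_pos_weibullMeasure k).mono fun x hx => hx.le)
  set E := ∫ x, x ∂(weibullMeasure k 1)
  unfold tourSum
  rw [integral_finsetSum _ fun σ _ =>
    (integrable_cityDist hk _ _).indicator (measurableSet_tourSet σ)]
  have hb : ∀ σ : Equiv.Perm (Fin (M + 3)),
      ∫ l, (tourSet (N := M + 2) σ).indicator
        (fun l => cityDist l (σ 0) (σ (Fin.last (M + 2)))) l ∂(edgeLaw (M + 3) k) ≤
      if σ 0 = 0 then 1 / (M + 1 : ℝ) * E * (1 / ((M + 1).factorial : ℝ)) else 0 := by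
    intro σ
    split_ifs with hσ
    · set z : {t : Fin (M + 2) // 0 ≤ t} := ⟨Fin.last (M + 1), Fin.zero_le _⟩ with hz
      -- The closing edge is the last entry of row `0`; the other rows contribute only the event
      -- that their diagonal entry is the least.
      set h : ∀ i : Fin (M + 2), ({t : Fin (M + 2) // i ≤ t} → ℝ) → ℝ := fun i =>
        {y | IsLeastAt (⟨i, le_rfl⟩ : {t : Fin (M + 2) // i ≤ t}) y}.indicator
          (fun y => if hi : i = 0 then y ⟨Fin.last (M + 1), Fin.le_last _⟩ else 1) with hh
      have hprod : ∀ l : Edge (M + 3) → ℝ, (tourSet (N := M + 2) σ).indicator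
          (fun l => cityDist l (σ 0) (σ (Fin.last (M + 2)))) l =
          ∏ i, h i (fun t => l (tourEdge σ ⟨i, t⟩)) := by
        intro l
        simp only [hh, indicator_apply, mem_tourSet_iff, mem_ofPred_eq, hσ, true_and]
        rw [Finset.prod_ite_zero, Fin.prod_univ_succ]
        have : ∀ i : Fin (M + 1), (if hi : i.succ = 0 then
          l (tourEdge σ ⟨i.succ, ⟨Fin.last (M + 1), Fin.le_last _⟩⟩) else (1 : ℝ)) = 1 :=
          fun i => dif_neg (Fin.succ_ne_zero i)
        simp only [this, Finset.prod_const_one, mul_one, dif_pos, Finset.mem_univ, true_implies]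
        congr 1
        rw [tourEdge, ← cityDist_eq_edgeOf l]
        simp [hσ]
      simp_rw [hprod]
      rw [integral_prod_tour_rows (N := M + 2) hk σ (h := h), Fin.prod_univ_succ]
      · have h0 : ∫ y, h 0 y ∂(Measure.pi fun _ => weibullMeasure k 1) ≤ 1 / (M + 1 : ℝ) * E := by
          have := integral_indicator_isLeastAt_eval_le hk
            (a := (⟨0, le_rfl⟩ : {t : Fin (M + 2) // 0 ≤ t})) (b := z)
            -- Row `0` has `M + 2 ≥ 2` entries, so the closing edge is not the first step of the
            -- tour.
            (fun h => by
              have := congrArg (fun t => t.1.val) h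
              simp [hz] at this)
          rw [card_row] at this
          simp only [hh, dif_pos]
          convert this using 3
          rw [Fin.val_zero]
          push_cast
          ring
        have hs : ∀ i : Fin (M + 1), ∫ y, h i.succ y ∂(Measure.pi fun _ => weibullMeasure k 1) =
            1 / ((M + 1 - i : ℕ) : ℝ) := by
          intro i
          simp only [hh, Fin.succ_ne_zero, dite_false]
          have := measureReal_isLeastAt_weibullMeasure hk
            (⟨i.succ, le_rfl⟩ : {t : Fin (M + 2) // i.succ ≤ t})
          rw [card_row] at this
          rw [integral_indicator_const _ (measurableSet_isLeastAt _), this]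
          simp
        simp_rw [hs]
        rw [prod_one_div_sub_eq]
        exact mul_le_mul_of_nonneg_right h0 (by positivity)
      · intro i
        refine Measurable.indicator ?_ (measurableSet_isLeastAt _)
        split_ifs <;> fun_prop
    · simp [tourSet_eq_empty (N := M + 2) hσ]
  refine (Finset.sum_le_sum fun σ _ => hb σ).trans ?_
  rw [← Finset.sum_filter, Finset.sum_const, card_filter_perm_map_zero (N := M + 2), nsmul_eq_mul,
    Nat.factorial_succ]
  have hf : ((M + 1).factorial : ℝ) ≠ 0 := by positivity
  -- There are `(M + 2)!` permutations fixing `0`; the quotient `(M + 2) / (M + 1) ≤ 2` gives the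
  -- constant.
  have : (((M + 1 + 1) * (M + 1).factorial : ℕ) : ℝ) *
      (1 / (M + 1 : ℝ) * E * (1 / ((M + 1).factorial : ℝ))) = (M + 2) / (M + 1) * E := by
    push_cast
    field_simp
    ring
  rw [this]
  refine mul_le_mul_of_nonneg_right ?_ hE
  rw [div_le_iff₀ (by positivity)]
  have : (0 : ℝ) ≤ M := M.cast_nonneg
  linarith

end Edges

/-! ### Asymptotics of the normalising constants -/

lemma tendsto_div_of_abs_sub_le {a D : ℕ → ℝ} {C K : ℝ} (h : ∀ n, |a n - C * D n| ≤ K)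
    (hD : Tendsto D atTop atTop) : Tendsto (fun n => a n / D n) atTop (𝓝 C) := by
  have h1 : Tendsto (fun n => (a n - C * D n) / D n) atTop (𝓝 0) := by
    refine squeeze_zero_norm' (a := fun n => K / D n) ?_ (hD.const_div_atTop K)
    filter_upwards [hD.eventually_gt_atTop 0] with n hn
    rw [Real.norm_eq_abs, abs_div, abs_of_pos hn]
    exact div_le_div_of_nonneg_right (h n) hn.le
  have h2 := h1.add_const C
  rw [zero_add] at h2
  refine h2.congr' ?_
  filter_upwards [hD.eventually_gt_atTop 0] with n hn
  field_simp
  ring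

/-- Comparison of the sum with `∫ x ^ (-p)` over `[1, N + 1]`; the error is bounded by the first
term and the value of the antiderivative at `1`. -/
lemma abs_sum_rpow_sub_le {p : ℝ} (hp0 : 0 < p) (hp1 : p < 1) (N : ℕ) :
    |∑ m ∈ Finset.range N, ((m : ℝ) + 1) ^ (-p) - 1 / (1 - p) * ((N : ℝ) + 1) ^ (1 - p)| ≤
      1 / (1 - p) := by
  have h1p : 0 < 1 - p := by linarith
  have hanti : AntitoneOn (fun x : ℝ => x ^ (-p)) (Icc 1 (1 + N)) := by
    intro x hx y hy hxy
    exact Real.rpow_le_rpow_of_nonpos (by linarith [hx.1]) hxy (by linarith)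
  have hint : ∫ x in (1 : ℝ)..1 + N, x ^ (-p) = 1 / (1 - p) * (((N : ℝ) + 1) ^ (1 - p) - 1) := by
    rw [integral_rpow (Or.inl (by linarith))]
    rw [show -p + 1 = 1 - p by ring, Real.one_rpow, add_comm (1 : ℝ) N]
    ring
  have hlow := hanti.integral_le_sum
  have hupp := hanti.sum_le_integral
  rw [hint] at hlow hupp
  have e1 : ∑ i ∈ Finset.range N, (1 + (i : ℝ)) ^ (-p) =
      ∑ m ∈ Finset.range N, ((m : ℝ) + 1) ^ (-p) :=
    Finset.sum_congr rfl fun i _ => by rw [add_comm]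
  have e2 : ∑ m ∈ Finset.range N, ((m : ℝ) + 1) ^ (-p) ≤
      ∑ i ∈ Finset.range N, (1 + ((i + 1 : ℕ) : ℝ)) ^ (-p) + 1 := by
    have h := Finset.sum_range_succ' (fun m : ℕ => ((m : ℝ) + 1) ^ (-p)) N
    have h' := Finset.sum_range_succ (fun m : ℕ => ((m : ℝ) + 1) ^ (-p)) N
    have hpos : 0 ≤ ((N : ℝ) + 1) ^ (-p) := by positivity
    have e3 : ∑ i ∈ Finset.range N, (1 + ((i + 1 : ℕ) : ℝ)) ^ (-p) =
        ∑ i ∈ Finset.range N, (((i + 1 : ℕ) : ℝ) + 1) ^ (-p) :=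
      Finset.sum_congr rfl fun i _ => by rw [add_comm]
    simp only [Nat.cast_zero, zero_add, Real.one_rpow] at h
    rw [e3]
    linarith
  rw [e1] at hlow
  have hge : 1 ≤ 1 / (1 - p) := by
    rw [le_div_iff₀ h1p]
    linarith
  rw [abs_le]
  constructor <;> linarith

lemma tendsto_sum_rpow_div {p : ℝ} (hp0 : 0 < p) (hp1 : p < 1) :
    Tendsto (fun N : ℕ => (∑ m ∈ Finset.range N, ((m : ℝ) + 1) ^ (-p)) / ((N : ℝ) + 1) ^ (1 - p))
      atTop (𝓝 (1 / (1 - p))) :=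
  tendsto_div_of_abs_sub_le (abs_sum_rpow_sub_le hp0 hp1) <|
    (tendsto_rpow_atTop (by linarith)).comp
      (tendsto_atTop_add_const_right _ 1 tendsto_natCast_atTop_atTop)

lemma tendsto_harmonic_div_log :
    Tendsto (fun N : ℕ => (∑ m ∈ Finset.range N, ((m : ℝ) + 1)⁻¹) / Real.log ((N : ℝ) + 1))
      atTop (𝓝 1) := by
  refine tendsto_div_of_abs_sub_le (K := 1) (fun N => ?_) <| Real.tendsto_log_atTop.comp
    (tendsto_atTop_add_const_right _ 1 tendsto_natCast_atTop_atTop)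
  have h : (∑ m ∈ Finset.range N, ((m : ℝ) + 1)⁻¹) = (harmonic N : ℝ) := by
    simp [harmonic]
  have h1 := log_add_one_le_harmonic N
  have h2 := harmonic_le_one_add_log N
  have h3 : Real.log N ≤ Real.log (N + 1) := by
    rcases N.eq_zero_or_pos with rfl | hN
    · simp
    · exact Real.log_le_log (by exact_mod_cast hN) (by linarith)
  rw [h, abs_le]
  push_cast at h1
  constructor <;> linarith

/-! ### The length of the nearest neighbour tour -/

section Tour

variable {N : ℕ} {k : ℝ} {Ω : Type*} [MeasurableSpace Ω] {P : Measure Ω}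
  {L : Edge (N + 1) → Ω → ℝ}

/-- The length of the edge that closes the tour `σ`. -/
def closingLength (l : Edge (N + 1) → ℝ) (σ : Equiv.Perm (Fin (N + 1))) : ℝ :=
  cityDist l (σ 0) (σ (Fin.last N))

lemma hasLaw_edgeLaw {n : ℕ} {L : Edge n → Ω → ℝ} (hlaw : ∀ e, HasLaw (L e) (weibullMeasure k 1) P)
    (hindep : iIndepFun L P) : HasLaw (fun ω e => L e ω) (edgeLaw n k) P :=
  hindep.hasLaw_pi hlaw

lemma ae_exists_mem_tourSet (hl : HasLaw (fun ω e => L e ω) (edgeLaw (N + 1) k) P)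
    (hex : ∀ ω, ∃ σ, (fun e => L e ω) ∈ tourSet (N := N) σ) :
    ∀ᵐ l ∂(edgeLaw (N + 1) k), ∃ σ, l ∈ tourSet (N := N) σ := by
  have hm : MeasurableSet {l | ∃ σ, l ∈ tourSet (N := N) σ} := by
    have : {l | ∃ σ, l ∈ tourSet (N := N) σ} = ⋃ σ, tourSet (N := N) σ := by
      ext
      simp
    rw [this]
    exact MeasurableSet.iUnion measurableSet_tourSet
  rw [← hl.map_eq]
  exact (ae_map_iff hl.aemeasurable hm).2 (ae_of_all _ hex)

/-- The selection `v` need not be measurable. By almost sure uniqueness the tour length agrees with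
a measurable function of the edge lengths alone. -/
lemma tourLength_ae_eq (hk : 0 < k) (hl : HasLaw (fun ω e => L e ω) (edgeLaw (N + 1) k) P)
    {v : Ω → Equiv.Perm (Fin (N + 1))} (hv : ∀ ω, IsNNTour (cityDist fun e => L e ω) (v ω)) :
    (fun ω => tourLength (cityDist fun e => L e ω) (v ω)) =ᵐ[P]
      (fun l => tourSum pathLength l + tourSum closingLength l) ∘ fun ω e => L e ω := by
  have hu := ae_sum_indicator_tourSet_eq_one hk (ae_exists_mem_tourSet hl fun ω => ⟨v ω, hv ω⟩)
  rw [← hl.map_eq] at hu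
  filter_upwards [ae_of_ae_map hl.aemeasurable hu] with ω hω
  rw [Function.comp_apply, tourSum_eq _ hω (hv ω), tourSum_eq _ hω (hv ω),
    tourLength_eq_pathLength_add]
  rfl

lemma measurable_tourSum_pathLength : Measurable (tourSum (N := N) pathLength) :=
  measurable_tourSum measurable_pathLength

lemma measurable_tourSum_closingLength : Measurable (tourSum (N := N) closingLength) :=
  measurable_tourSum fun _ => measurable_cityDist _ _

lemma integrable_tourSum_pathLength (hk : 0 < k) :
    Integrable (tourSum (N := N) pathLength) (edgeLaw (N + 1) k) :=
  integrable_tourSum (integrable_pathLength hk)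

lemma integrable_tourSum_closingLength (hk : 0 < k) :
    Integrable (tourSum (N := N) closingLength) (edgeLaw (N + 1) k) :=
  integrable_tourSum fun _ => integrable_cityDist hk _ _

lemma ae_tourSum_closingLength_nonneg (hk : 0 < k) :
    ∀ᵐ l ∂(edgeLaw (N + 1) k), 0 ≤ tourSum (N := N) closingLength l := by
  have := isProbabilityMeasure_weibullMeasure hk
  have h : ∀ᵐ l ∂(edgeLaw (N + 1) k), ∀ e, 0 < l e :=
    ae_all_iff.2 fun e =>
      (measurePreserving_eval (fun _ : Edge (N + 1) => weibullMeasure k 1)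
        e).quasiMeasurePreserving.ae (ae_pos_weibullMeasure k)
  filter_upwards [h] with l hl
  refine Finset.sum_nonneg fun σ _ => indicator_apply_nonneg fun _ => ?_
  unfold closingLength cityDist
  split_ifs
  · exact (hl _).le
  · exact (hl _).le
  · exact le_rfl

lemma integrable_tourLength (hk : 0 < k) (hl : HasLaw (fun ω e => L e ω) (edgeLaw (N + 1) k) P)
    {v : Ω → Equiv.Perm (Fin (N + 1))} (hv : ∀ ω, IsNNTour (cityDist fun e => L e ω) (v ω)) :
    Integrable (fun ω => tourLength (cityDist fun e => L e ω) (v ω)) P := by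
  refine Integrable.congr ?_ (tourLength_ae_eq hk hl hv).symm
  have h := (integrable_tourSum_pathLength (N := N) hk).add (integrable_tourSum_closingLength hk)
  rw [← hl.map_eq] at h
  exact h.comp_aemeasurable hl.aemeasurable

end Tour

/-! ### The central limit theorem with general normalisation -/

lemma prod_fin_sub_eq_prod_range (N : ℕ) (f : ℕ → ℂ) :
    ∏ i : Fin N, f (N - i) = ∏ m ∈ Finset.range N, f (m + 1) := by
  rw [Fin.prod_univ_eq_prod_range (fun i => f (N - i)) N,
    ← Finset.prod_range_reflect (fun m => f (m + 1))]
  refine Finset.prod_congr rfl fun i hi => ?_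
  have := Finset.mem_range.1 hi
  rw [show N - 1 - i + 1 = N - i by omega]

lemma memLp_id_weibullMeasure {k : ℝ} (hk : 0 < k) : MemLp id 2 (weibullMeasure k 1) :=
  (memLp_two_iff_integrable_sq aestronglyMeasurable_id).2 (integrable_pow_weibullMeasure hk 2)

/-- The law of a centred Weibull variable. -/
def centredWeibull (k : ℝ) : Measure ℝ :=
  (weibullMeasure k 1).map fun x => x - ∫ y, y ∂(weibullMeasure k 1)

lemma isProbabilityMeasure_centredWeibull {k : ℝ} (hk : 0 < k) :
    IsProbabilityMeasure (centredWeibull k) := by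
  have := isProbabilityMeasure_weibullMeasure hk
  exact Measure.isProbabilityMeasure_map (by fun_prop)

lemma memLp_id_centredWeibull {k : ℝ} (hk : 0 < k) : MemLp id 2 (centredWeibull k) := by
  have := isProbabilityMeasure_weibullMeasure hk
  rw [centredWeibull, memLp_map_measure_iff aestronglyMeasurable_id (by fun_prop)]
  exact (memLp_id_weibullMeasure hk).sub (memLp_const _)

lemma integral_id_centredWeibull {k : ℝ} (hk : 0 < k) : ∫ x, x ∂(centredWeibull k) = 0 := by
  have := isProbabilityMeasure_weibullMeasure hk
  have h1 : Integrable (fun x : ℝ => x) (weibullMeasure k 1) := by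
    simpa using integrable_pow_weibullMeasure hk 1
  rw [centredWeibull, integral_map (by fun_prop) (by fun_prop), integral_sub h1 (integrable_const _)]
  simp

lemma integral_sq_centredWeibull {k : ℝ} (hk : 0 < k) :
    ∫ x, x ^ 2 ∂(centredWeibull k) = Real.Gamma (2 / k + 1) - Real.Gamma (1 + 1 / k) ^ 2 := by
  have := isProbabilityMeasure_weibullMeasure hk
  have h := variance_eq_sub (memLp_id_weibullMeasure hk)
  rw [variance_eq_integral aemeasurable_id] at h
  rw [centredWeibull, integral_map (by fun_prop) (by fun_prop)]
  have h1 := integral_pow_weibullMeasure hk 1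
  have h2 := integral_pow_weibullMeasure hk 2
  simp only [pow_one, Nat.cast_one, Nat.cast_ofNat] at h1 h2
  simp only [id_eq, Pi.pow_apply] at h
  rw [h, h2, h1, add_comm (1 / k)]

/-- The central limit theorem for nearest neighbour tours, for general normalising constants. -/
lemma tendstoInDistribution_tourLength {k : ℝ} (hk : 0 < k)
    {Ω : ℕ → Type*} [∀ n, MeasurableSpace (Ω n)]
    (P : ∀ n, Measure (Ω n)) [∀ n, IsProbabilityMeasure (P n)]
    (L : ∀ n, Edge n → Ω n → ℝ)
    (hlaw : ∀ n e, HasLaw (L n e) (weibullMeasure k 1) (P n))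
    (hindep : ∀ n, iIndepFun (L n) (P n))
    (v : ∀ n, Ω n → Equiv.Perm (Fin n))
    (hv : ∀ n ω, IsNNTour (cityDist fun e => L n e ω) (v n ω))
    (T : ∀ n, Ω n → ℝ)
    (hT : ∀ n ω, T n ω = tourLength (cityDist fun e => L n e ω) (v n ω))
    (hTi : ∀ n, Integrable (T n) (P n))
    {c : ℕ → ℝ} (hc : Tendsto c atTop atTop) {V : ℝ}
    (hV : Tendsto (fun N : ℕ => ∑ m ∈ Finset.range N,
      (((m + 1 : ℕ) : ℝ) ^ (-(1 / k)) / c (N + 1)) ^ 2) atTop (𝓝 V)) :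
    TendstoInDistribution (fun n ω => (T n ω - ∫ ω', T n ω' ∂(P n)) / c n) atTop (id : ℝ → ℝ) P
      (gaussianReal 0 (V * (Real.Gamma (2 / k + 1) - Real.Gamma (1 + 1 / k) ^ 2)).toNNReal) where
  forall_aemeasurable n :=
    ((hTi n).aestronglyMeasurable.aemeasurable.sub_const _).div_const _
  aemeasurable_limit := aemeasurable_id
  tendsto := by
    have := isProbabilityMeasure_weibullMeasure hk
    have := isProbabilityMeasure_centredWeibull hk
    refine ProbabilityMeasure.tendsto_iff_tendsto_charFun.2 fun s => ?_
    -- With `N + 1` cities the open path has `N` edges, whence the mixture of `range N` and `c (N +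
    -- 1)`.
    rw [← tendsto_add_atTop_iff_nat 1]
    simp only [ProbabilityMeasure.coe_mk, Measure.map_id]
    have hl : ∀ N, HasLaw (fun ω e => L (N + 1) e ω) (edgeLaw (N + 1) k) (P (N + 1)) := fun N =>
      hasLaw_edgeLaw (hlaw (N + 1)) (hindep (N + 1))
    set μ := ∫ y, y ∂(weibullMeasure k 1)
    have hgauss := tendsto_prod_charFun_mul (memLp_id_centredWeibull hk)
      (integral_id_centredWeibull hk)
      (w := fun N m => ((m + 1 : ℕ) : ℝ) ^ (-(1 / k)) / c (N + 1))
      (c := fun N => |c (N + 1)|⁻¹) (fun N m => by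
        rw [abs_div, div_eq_mul_inv, abs_of_nonneg (by positivity)]
        refine mul_le_of_le_one_left (by positivity) ?_
        refine Real.rpow_le_one_of_one_le_of_nonpos (by simp) ?_
        rw [neg_nonpos]
        positivity)
      ((tendsto_abs_atTop_atTop.comp
        (hc.comp (tendsto_add_atTop_nat 1))).inv_tendsto_atTop) hV s
    rw [integral_sq_centredWeibull hk] at hgauss
    have hdiff : Tendsto (fun N => charFun ((P (N + 1)).map
          fun ω => (T (N + 1) ω - ∫ ω', T (N + 1) ω' ∂(P (N + 1))) / c (N + 1)) s -
        ∏ m ∈ Finset.range N,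
          charFun (centredWeibull k) (((m + 1 : ℕ) : ℝ) ^ (-(1 / k)) / c (N + 1) * s))
        atTop (𝓝 0) := by
      have hbound : Tendsto (fun N => |s| * (4 * μ / c (N + 1))) atTop (𝓝 0) := by
        have := ((hc.comp (tendsto_add_atTop_nat 1)).const_div_atTop (4 * μ)).const_mul |s|
        simpa using this
      refine squeeze_zero_norm' ?_ hbound
      have hcpos : ∀ᶠ N in atTop, 0 < c (N + 1) :=
        (hc.comp (tendsto_add_atTop_nat 1)).eventually_gt_atTop 0
      -- The bound on the closing edge needs at least three cities.
      filter_upwards [hcpos, eventually_ge_atTop 2] with N hcN hN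
      set Q := edgeLaw (N + 1) k
      have hQ : IsProbabilityMeasure Q := isProbabilityMeasure_edgeLaw _ hk
      have hae : T (N + 1) =ᵐ[P (N + 1)]
          (fun l => tourSum pathLength l + tourSum closingLength l) ∘
            fun ω e => L (N + 1) e ω := by
        rw [show T (N + 1) = _ from funext (hT (N + 1))]
        exact tourLength_ae_eq hk (hl N) (hv (N + 1))
      set S : (Edge (N + 1) → ℝ) → ℝ := tourSum pathLength
      set R : (Edge (N + 1) → ℝ) → ℝ := tourSum closingLength
      have hSi : Integrable S Q := integrable_tourSum_pathLength hk
      have hRi : Integrable R Q := integrable_tourSum_closingLength hk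
      have hSm : Measurable S := measurable_tourSum_pathLength
      have hRm : Measurable R := measurable_tourSum_closingLength
      have hex := ae_exists_mem_tourSet (hl N) fun ω => ⟨v (N + 1) ω, hv (N + 1) ω⟩
      have hET : ∫ ω', T (N + 1) ω' ∂(P (N + 1)) = ∫ l, S l ∂Q + ∫ l, R l ∂Q := by
        rw [integral_congr_ae hae, ← integral_add hSi hRi]
        exact (hl N).integral_comp (hSm.add hRm).aestronglyMeasurable
      have hmap : (P (N + 1)).map
          (fun ω => (T (N + 1) ω - ∫ ω', T (N + 1) ω' ∂(P (N + 1))) / c (N + 1)) =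
          Q.map fun l => (S l + R l - (∫ l, S l ∂Q + ∫ l, R l ∂Q)) / c (N + 1) := by
        rw [hET]
        generalize (∫ l, S l ∂Q) + ∫ l, R l ∂Q = I
        have hm : Measurable fun l => (S l + R l - I) / c (N + 1) := by fun_prop
        have e := AEMeasurable.map_map_of_aemeasurable (μ := P (N + 1)) hm.aemeasurable
          (hl N).aemeasurable
        rw [(hl N).map_eq] at e
        refine (Measure.map_congr ?_).trans e.symm
        filter_upwards [hae] with ω hω
        rw [hω]
        rfl
      have hQS : IsProbabilityMeasure (Q.map S) :=
        Measure.isProbabilityMeasure_map hSm.aemeasurable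
      have hcf := (integral_eq_and_charFun_of_charFun_eq
        ((memLp_id_weibullMeasure hk).integrable (by norm_num))
        (b := fun i : Fin N => ((N - i : ℕ) : ℝ) ^ (-(1 / k))) (ρ := Q.map S)
        (charFun_map_tourSum_pathLength hk hex)).2 (c (N + 1)) s
      rw [Measure.map_map (by fun_prop) hSm, integral_map hSm.aemeasurable (by fun_prop)] at hcf
      replace hcf := hcf.trans (prod_fin_sub_eq_prod_range N (fun m => charFun (centredWeibull k)
        ((m : ℝ) ^ (-(1 / k)) / c (N + 1) * s)))
      rw [hmap, ← hcf]
      have hi1 : Integrable (fun l => (S l + R l - (∫ l, S l ∂Q + ∫ l, R l ∂Q)) / c (N + 1)) Q :=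
        ((hSi.add hRi).sub (integrable_const _)).div_const _
      have hi2 : Integrable ((fun x => (x - ∫ l, S l ∂Q) / c (N + 1)) ∘ S) Q :=
        (hSi.sub (integrable_const _)).div_const _
      refine (norm_charFun_map_sub_charFun_map_le hi1 hi2 s).trans ?_
      refine mul_le_mul_of_nonneg_left ?_ (abs_nonneg s)
      have hR0 : ∀ᵐ l ∂Q, 0 ≤ R l := ae_tourSum_closingLength_nonneg hk
      have hER0 : 0 ≤ ∫ l, R l ∂Q := integral_nonneg_of_ae hR0
      have hER : ∫ l, R l ∂Q ≤ 2 * μ := by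
        obtain ⟨M, rfl⟩ := Nat.exists_eq_add_of_le' hN
        exact integral_tourSum_cityDist_le hk M
      -- After centring, the two variables differ by `(R - E R) / c (N + 1)`, and `|R - E R| ≤ R + E
      -- R` because `R ≥ 0`. With `E R ≤ 2 μ` this gives `4 μ`.
      calc _ ≤ ∫ l, (R l + ∫ l, R l ∂Q) / c (N + 1) ∂Q := by
            refine integral_mono_ae (hi1.sub hi2).abs
              ((hRi.add (integrable_const _)).div_const _) ?_
            filter_upwards [hR0] with l hl0
            dsimp only [Function.comp_apply]
            rw [← sub_div, abs_div, abs_of_pos hcN]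
            refine div_le_div_of_nonneg_right ?_ hcN.le
            rw [abs_le]
            constructor <;> linarith
        _ = (2 * ∫ l, R l ∂Q) / c (N + 1) := by
            rw [integral_div, integral_add hRi (integrable_const _)]
            simp
            ring
        _ ≤ _ := by
            refine div_le_div_of_nonneg_right ?_ hcN.le
            linarith
    have := hdiff.add hgauss
    simpa using this

end NNTour

end

/-! ### The two regimes `α > 1` and `α = 1` -/

theorem theorem6 {α : ℝ} (hα : 1 ≤ α)
    {Ω : ℕ → Type*} [∀ n, MeasurableSpace (Ω n)]
    (P : ∀ n, Measure (Ω n)) [∀ n, IsProbabilityMeasure (P n)]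
    -- for every `n`, the i.i.d. Weibull distances between the `n` cities
    (L : ∀ n, NNTour.Edge n → Ω n → ℝ)
    (hlaw : ∀ n e, HasLaw (L n e) (NNTour.weibullMeasure (1 + α) 1) (P n))
    (hindep : ∀ n, iIndepFun (L n) (P n))
    -- a nearest neighbour tour for these distances, and its length
    (v : ∀ n, Ω n → Equiv.Perm (Fin n))
    (hv : ∀ n ω, NNTour.IsNNTour (NNTour.cityDist fun e => L n e ω) (v n ω))
    (T : ∀ n, Ω n → ℝ)
    (hT : ∀ n ω, T n ω = NNTour.tourLength (NNTour.cityDist fun e => L n e ω) (v n ω)) :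
    (∀ n, Integrable (T n) (P n)) ∧
    (1 < α →
      TendstoInDistribution
        (fun n ω => (T n ω - ∫ ω', T n ω' ∂(P n)) / (n : ℝ) ^ (1 / 2 - 1 / (1 + α) : ℝ))
        atTop (id : ℝ → ℝ) P
        (gaussianReal 0 ((α + 1) / (α - 1) * NNTour.sigmaSq α).toNNReal)) ∧
    (α = 1 →
      TendstoInDistribution
        (fun n ω => (T n ω - ∫ ω', T n ω' ∂(P n)) / Real.sqrt (Real.log n))
        atTop (id : ℝ → ℝ) P
        (gaussianReal 0 (NNTour.sigmaSq α).toNNReal)) := by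
  have hk : 0 < 1 + α := by linarith
  have hTi : ∀ n, Integrable (T n) (P n) := by
    intro n
    rw [show T n = _ from funext (hT n)]
    cases n with
    | zero => simp [NNTour.tourLength]
    | succ N =>
      exact NNTour.integrable_tourLength hk (NNTour.hasLaw_edgeLaw (hlaw _) (hindep _)) (hv _)
  refine ⟨hTi, fun h1 => ?_, fun h1 => ?_⟩
  · have hlt : 1 / (1 + α) < 1 / 2 := one_div_lt_one_div_of_lt (by norm_num) (by linarith)
    have hp0 : 0 < 2 / (1 + α) := by positivity
    have hp1 : 2 / (1 + α) < 1 := by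
      rw [div_lt_one hk]
      linarith
    refine NNTour.tendstoInDistribution_tourLength hk P L hlaw hindep v hv T hT hTi
      ((tendsto_rpow_atTop (by linarith)).comp tendsto_natCast_atTop_atTop) ?_
    -- With `p = 2 / (1 + α)` the squared weights are `(m + 1) ^ (-p)` and the squared normalising
    -- constant is `(N + 1) ^ (1 - p)`, so `V = 1 / (1 - p)`.
    have hlim := NNTour.tendsto_sum_rpow_div hp0 hp1
    have hV : 1 / (1 - 2 / (1 + α)) = (α + 1) / (α - 1) := by
      have : α - 1 ≠ 0 := by linarith
      rw [show 1 - 2 / (1 + α) = (α - 1) / (1 + α) by field_simp; ring, one_div_div, add_comm]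
    rw [hV] at hlim
    refine hlim.congr fun N => ?_
    rw [Finset.sum_div]
    refine Finset.sum_congr rfl fun m _ => ?_
    rw [Function.comp_apply, div_pow, ← Real.rpow_mul_natCast (by positivity),
      ← Real.rpow_mul_natCast (by positivity)]
    push_cast
    congr 2 <;> ring
  · subst h1
    have hc : Tendsto (fun n : ℕ => Real.sqrt (Real.log n)) atTop atTop :=
      Real.tendsto_sqrt_atTop.comp (Real.tendsto_log_atTop.comp tendsto_natCast_atTop_atTop)
    have h := NNTour.tendstoInDistribution_tourLength hk P L hlaw hindep v hv T hT hTi hc (V := 1) ?_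
    · rw [one_mul] at h
      exact h
    -- At `α = 1` the squared weights are `1 / (m + 1)`, so their sum is harmonic and `V = 1`.
    · refine NNTour.tendsto_harmonic_div_log.congr fun N => ?_
      rw [Finset.sum_div]
      refine Finset.sum_congr rfl fun m _ => ?_
      rw [div_pow, ← Real.rpow_mul_natCast (by positivity), Real.sq_sqrt (Real.log_natCast_nonneg _)]
      norm_num [Real.rpow_neg_one]
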